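/- Fix $T>0$. A *closed continuous 2-frieze pattern* of period $T$ is a pair $(F,G)$ of smooth functions $\mathbb R^2\to\mathbb R$ with $$G=FF_{xy}-F_xF_y,\qquad F=GG_{xy}-G_xG_y,$$ such that, for all $x,y$, $$F(x,x)=F_x(x,x)=F_y(x,x)=0,\quad F_{xx}(x,x)=F_{yy}(x,x)=1,\quad F_{xy}(x,x)=-1,\quad F(x+T,y)=F(x,y+T)=F(x,y),$$ and likewise for $G$. It is *positive* if $F(x,y)>0$ and $G(x,y)>0$ whenever $x<y<x+T$. A *closed locally convex curve* is a smooth parametrized curve $\gamma:\mathbb R/T\mathbb Z\to\mathbb{RP}^2$ such that, for local smooth lifts $v$ of $\gamma$ to $\mathbb R^3\setminus\{0\}$, the vectors $v,v',v''$ are linearly independent at every parameter. Two such curves are *projectively equivalent* if $\gamma_2=A\circ\gamma_1$ for some $A\in SL_3(\mathbb R)$. The curve is *convex* if every line of $\mathbb{RP}^2$ meets it at most twice, where the intersections are counted with multiplicity over the parameters in $\mathbb R/T\mathbb Z$. **Theorem.** Every closed locally convex curve $\gamma$ has a unique smooth lift $\Gamma:\mathbb R\to\mathbb R^3$ with $\det(\Gamma,\Gamma',\Gamma'')=1$.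 It also has a unique dual curve $\gamma^*$, a closed locally convex curve in $(\mathbb{RP}^2)^*$ (identified with $\mathbb{RP}^2$ through the dot product of $\mathbb R^3$) whose point with parameter $t$ is the tangent line of $\gamma$ at $t$. Let $\Gamma^*$ be the lift of $\gamma^*$ with $\det(\Gamma^*,{\Gamma^*}',{\Gamma^*}'')=1$. There is a bijection between the closed continuous 2-frieze patterns of period $T$ and the projective equivalence classes of closed locally convex curves $\mathbb R/T\mathbb Z\to\mathbb{RP}^2$ such that, if $(F,G)$ corresponds to the class of $\gamma$, then $$F(x,y)=\Gamma(x)\cdot\Gamma^*(y)\qquad\text{for all }x,y,$$ and $(F,G)$ is positive if and only if $\gamma$ is convex. -/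

import Mathlib

open scoped ContDiff Matrix LinearAlgebra.Projectivization

noncomputable section

namespace TwoFrieze

/-! ### Continuous 2-friezes -/

/-- Partial derivative with respect to the first variable. -/
def dx (F : ℝ → ℝ → ℝ) : ℝ → ℝ → ℝ := fun x y => deriv (fun s => F s y) x

/-- Partial derivative with respect to the second variable. -/
def dy (F : ℝ → ℝ → ℝ) : ℝ → ℝ → ℝ := fun x y => deriv (fun s => F x s) y

/-- The boundary conditions of a closed continuous 2-frieze of period `T`, for one of its two
functions. -/
structure IsClosedEntry (T : ℝ) (F : ℝ → ℝ → ℝ) : Prop where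
  diag : ∀ x, F x x = 0
  diag_x : ∀ x, dx F x x = 0
  diag_y : ∀ x, dy F x x = 0
  diag_xx : ∀ x, dx (dx F) x x = 1
  diag_yy : ∀ x, dy (dy F) x x = 1
  diag_xy : ∀ x, dy (dx F) x x = -1
  periodic_x : ∀ x y, F (x + T) y = F x y
  periodic_y : ∀ x y, F x (y + T) = F x y

/-- A closed continuous 2-frieze pattern of period `T`. -/
structure ClosedTwoFrieze (T : ℝ) where
  F : ℝ → ℝ → ℝ
  G : ℝ → ℝ → ℝ
  smooth_F : ContDiff ℝ ∞ (fun p : ℝ × ℝ => F p.1 p.2)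
  smooth_G : ContDiff ℝ ∞ (fun p : ℝ × ℝ => G p.1 p.2)
  G_eq : ∀ x y, G x y = F x y * dy (dx F) x y - dx F x y * dy F x y
  F_eq : ∀ x y, F x y = G x y * dy (dx G) x y - dx G x y * dy G x y
  closed_F : IsClosedEntry T F
  closed_G : IsClosedEntry T G

/-- Positivity of a closed continuous 2-frieze pattern. -/
def ClosedTwoFrieze.IsPositive {T : ℝ} (P : ClosedTwoFrieze T) : Prop :=
  ∀ x y, x < y → y < x + T → 0 < P.F x y ∧ 0 < P.G x y

/-! ### Closed locally convex curves in the projective plane -/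

/-- The Wronskian `det (v, v', v'')` of a curve in `ℝ³`. -/
def wronskian (v : ℝ → Fin 3 → ℝ) (t : ℝ) : ℝ :=
  (Matrix.of ![v t, deriv v t, deriv (deriv v) t]).det

/-- `v` is a smooth lift to `ℝ³ ∖ {0}`, over the open set of parameters `U`, of the curve `c`
in the projective plane. -/
structure IsLocalLift (c : ℝ → ℙ ℝ (Fin 3 → ℝ)) (U : Set ℝ) (v : ℝ → Fin 3 → ℝ) : Prop where
  isOpen : IsOpen U
  smooth : ContDiffOn ℝ ∞ v U
  lifts : ∀ t ∈ U, ∃ h : v t ≠ 0, c t = Projectivization.mk ℝ (v t) h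

/-- A closed locally convex parametrized curve `ℝ / Tℤ → ℝP²`, written as a `T`-periodic map
on `ℝ`. The curve is smooth (it has smooth local lifts), and it is an immersion without inflection
points: near each parameter it has a smooth lift `v` with `v, v', v''` linearly independent
there (this does not depend on the lift). -/
structure ClosedCurve (T : ℝ) where
  toFun : ℝ → ℙ ℝ (Fin 3 → ℝ)
  periodic : Function.Periodic toFun T
  locally_convex : ∀ t, ∃ U v, t ∈ U ∧ IsLocalLift toFun U v ∧ wronskian v t ≠ 0

instance (T : ℝ) : CoeFun (ClosedCurve T) (fun _ => ℝ → ℙ ℝ (Fin 3 → ℝ)) :=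
  ⟨ClosedCurve.toFun⟩

/-- Projective equivalence of parametrized curves: `SL₃(ℝ)` acts on the projective plane. -/
def projEquiv (T : ℝ) : Setoid (ClosedCurve T) where
  r γ₁ γ₂ := ∃ A : Matrix.SpecialLinearGroup (Fin 3) ℝ, ∀ t, γ₂ t = A • γ₁ t
  iseqv :=
    { refl := fun γ => ⟨1, fun t => (one_smul _ (γ t)).symm⟩
      symm := by
        rintro γ₁ γ₂ ⟨A, hA⟩
        exact ⟨A⁻¹, fun t => by rw [hA t, inv_smul_smul]⟩
      trans := by
        rintro γ₁ γ₂ γ₃ ⟨A, hA⟩ ⟨B, hB⟩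
        exact ⟨B * A, fun t => by rw [hB t, hA t, mul_smul]⟩ }

/-- `Γ` is the lift of `γ` to `ℝ³` normalized by `det (Γ, Γ', Γ'') = 1`. -/
structure IsNormalizedLift {T : ℝ} (γ : ClosedCurve T) (Γ : ℝ → Fin 3 → ℝ) : Prop where
  isLift : IsLocalLift γ Set.univ Γ
  wronskian_eq : ∀ t, wronskian Γ t = 1

/-- `δ` is the dual curve of `γ`: the point `δ t` of the dual plane is the tangent line of `γ`
at `t`. The dual plane is identified with the plane through the dot product of `ℝ³`; the tangent
line is the projectivization of the span of `v t` and `v' t`, for `v` a local lift of `γ`. -/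
def IsDualCurve {T : ℝ} (γ δ : ClosedCurve T) : Prop :=
  ∀ t, ∀ U v, t ∈ U → IsLocalLift γ U v →
    (δ t).rep ⬝ᵥ v t = 0 ∧ (δ t).rep ⬝ᵥ deriv v t = 0

/-- The curve `γ` meets the line `{ℓ = 0}` at the parameter `t` with multiplicity at least `n`:
the function `ℓ ⬝ᵥ v`, for a local lift `v`, vanishes at `t` with its derivatives of order `< n`. -/
def MeetsToOrder {T : ℝ} (γ : ClosedCurve T) (ℓ : Fin 3 → ℝ) (t : ℝ) (n : ℕ) : Prop :=
  ∃ U v, t ∈ U ∧ IsLocalLift γ U v ∧ ∀ i < n, iteratedDeriv i (fun s => ℓ ⬝ᵥ v s) t = 0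

/-- The multiplicity of the intersection of `γ` with the line `{ℓ = 0}` at the parameter `t`. -/
def interMult {T : ℝ} (γ : ClosedCurve T) (ℓ : Fin 3 → ℝ) (t : ℝ) : ℕ∞ :=
  ⨆ (n : ℕ) (_ : MeetsToOrder γ ℓ t n), (n : ℕ∞)

/-- A closed curve is convex if every line meets it at most twice, the intersections being counted
with multiplicity, over the parameters in one period. -/
def ClosedCurve.IsConvex {T : ℝ} (γ : ClosedCurve T) : Prop :=
  ∀ ℓ : Fin 3 → ℝ, ℓ ≠ 0 → ∀ s : Finset ℝ, (∀ t ∈ s, 0 ≤ t ∧ t < T) →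
    ∑ t ∈ s, interMult γ ℓ t ≤ 2

end TwoFrieze

end

noncomputable section

namespace TwoFrieze

/-! ### Vector calculus in three dimensions -/

/-! Scaling a lift by `g` multiplies its Wronskian by `g ^ 3`. As real cube roots are unique, sign
included, the normalization selects one lift: local choices glue, and the lift Γ is periodic. The
lift of the dual curve is then Γ* = Γ × Γ', and Γ* × Γ*' = Γ. With F = Γ(x)·Γ*(y) and G =
Γ*(x)·Γ(y), the frieze rule is the Binet–Cauchy identity for (Γ × Γ')(x)·(Γ* × Γ*')(y)
(`IsDualPair.frieze_rule`).

Conversely, let W be the 3 × 3 determinant of the derivatives ∂ₓⁱ∂ᵧʲF with i, j ≤ 2. Dodgson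
condensation turns the two frieze equations into F = F·W. Hence W takes only the values 0 and 1; it
is 1 on the diagonal, so W = 1 by connectedness. Differentiating W = 1 shows that every F(·, y)
solves one equation u''' = a u + b u' with coefficients independent of y (`exists_ode`). The curve
(F, F_y, F_yy)(x, 0) has Wronskian 1 and solves it too, so the values of F, F_x, F_xx on the
diagonal force F = Γ·Γ* (`F_eq_dot`). The curve is determined up to SL₃, because (Γ*, Γ*', Γ*'')(0)
is a unimodular change of basis.

Positivity says that a tangent line does not meet the curve again within a period, with a definite
sign. Convexity gives this by counting multiplicities. Conversely, Rolle's theorem for a quotient of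
two linear forms along Γ excludes three simple intersections (`not_three_zeros`). -/

theorem hasDerivAt_dotProduct {a b : ℝ → Fin 3 → ℝ} {a' b' : Fin 3 → ℝ} {t : ℝ}
    (ha : HasDerivAt a a' t) (hb : HasDerivAt b b' t) :
    HasDerivAt (fun s => a s ⬝ᵥ b s) (a' ⬝ᵥ b t + a t ⬝ᵥ b') t := by
  rw [hasDerivAt_pi] at ha hb
  simp only [Matrix.vec3_dotProduct]
  refine ((((ha 0).fun_mul (hb 0)).fun_add ((ha 1).fun_mul (hb 1))).fun_add
    ((ha 2).fun_mul (hb 2))).congr_deriv ?_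
  ring

theorem hasDerivAt_crossProduct {a b : ℝ → Fin 3 → ℝ} {a' b' : Fin 3 → ℝ} {t : ℝ}
    (ha : HasDerivAt a a' t) (hb : HasDerivAt b b' t) :
    HasDerivAt (fun s => a s ⨯₃ b s) (a' ⨯₃ b t + a t ⨯₃ b') t := by
  rw [hasDerivAt_pi] at *
  intro i
  fin_cases i
  · refine (((ha 1).fun_mul (hb 2)).fun_sub ((ha 2).fun_mul (hb 1))).congr_deriv ?_
    simp [cross_apply]; ring
  · refine (((ha 2).fun_mul (hb 0)).fun_sub ((ha 0).fun_mul (hb 2))).congr_deriv ?_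
    simp [cross_apply]; ring
  · refine (((ha 0).fun_mul (hb 1)).fun_sub ((ha 1).fun_mul (hb 0))).congr_deriv ?_
    simp [cross_apply]; ring

theorem contDiffOn_dotProduct {a b : ℝ → Fin 3 → ℝ} {U : Set ℝ}
    (ha : ContDiffOn ℝ ∞ a U) (hb : ContDiffOn ℝ ∞ b U) :
    ContDiffOn ℝ ∞ (fun s => a s ⬝ᵥ b s) U := by
  rw [contDiffOn_pi] at ha hb
  simp only [Matrix.vec3_dotProduct]
  exact (((ha 0).mul (hb 0)).add ((ha 1).mul (hb 1))).add ((ha 2).mul (hb 2))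

theorem contDiffOn_crossProduct {a b : ℝ → Fin 3 → ℝ} {U : Set ℝ}
    (ha : ContDiffOn ℝ ∞ a U) (hb : ContDiffOn ℝ ∞ b U) :
    ContDiffOn ℝ ∞ (fun s => a s ⨯₃ b s) U := by
  rw [contDiffOn_pi] at *
  intro i
  fin_cases i
  · simpa [cross_apply] using ((ha 1).mul (hb 2)).sub ((ha 2).mul (hb 1))
  · simpa [cross_apply] using ((ha 2).mul (hb 0)).sub ((ha 0).mul (hb 2))
  · simpa [cross_apply] using ((ha 0).mul (hb 1)).sub ((ha 1).mul (hb 0))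

theorem wronskian_eq_triple (v : ℝ → Fin 3 → ℝ) (t : ℝ) :
    wronskian v t = v t ⬝ᵥ deriv v t ⨯₃ deriv (deriv v) t :=
  (triple_product_eq_det _ _ _).symm

section Smooth

variable {U : Set ℝ} {t : ℝ}

theorem contDiffOn_deriv {E : Type*} [NormedAddCommGroup E] [NormedSpace ℝ E] {f : ℝ → E}
    (hU : IsOpen U) (hf : ContDiffOn ℝ ∞ f U) : ContDiffOn ℝ ∞ (deriv f) U :=
  ((contDiffOn_infty_iff_deriv_of_isOpen hU).1 hf).2

theorem hasDerivAt_of_contDiffOn {E : Type*} [NormedAddCommGroup E] [NormedSpace ℝ E]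
    {f : ℝ → E} (hU : IsOpen U) (hf : ContDiffOn ℝ ∞ f U) (ht : t ∈ U) :
    HasDerivAt f (deriv f t) t :=
  ((hf.contDiffAt (hU.mem_nhds ht)).differentiableAt (by simp)).hasDerivAt

theorem contDiffOn_wronskian {v : ℝ → Fin 3 → ℝ} (hU : IsOpen U) (hv : ContDiffOn ℝ ∞ v U) :
    ContDiffOn ℝ ∞ (wronskian v) U := by
  have h1 := contDiffOn_deriv hU hv
  have := contDiffOn_dotProduct hv (contDiffOn_crossProduct h1 (contDiffOn_deriv hU h1))
  rwa [show wronskian v = _ from funext (wronskian_eq_triple v)]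

theorem deriv_smul_eqOn {g : ℝ → ℝ} {v w : ℝ → Fin 3 → ℝ} (hU : IsOpen U)
    (hg : ContDiffOn ℝ ∞ g U) (hw : ContDiffOn ℝ ∞ w U) (h : ∀ s ∈ U, v s = g s • w s) :
    ∀ s ∈ U, deriv v s = g s • deriv w s + deriv g s • w s := by
  intro s hs
  have he : v =ᶠ[nhds s] fun r => g r • w r :=
    Filter.eventually_of_mem (hU.mem_nhds hs) h
  rw [he.deriv_eq]
  exact ((hasDerivAt_of_contDiffOn hU hg hs).smul (hasDerivAt_of_contDiffOn hU hw hs)).deriv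

theorem deriv_deriv_smul_eqOn {g : ℝ → ℝ} {v w : ℝ → Fin 3 → ℝ} (hU : IsOpen U)
    (hg : ContDiffOn ℝ ∞ g U) (hw : ContDiffOn ℝ ∞ w U) (h : ∀ s ∈ U, v s = g s • w s) :
    ∀ s ∈ U, deriv (deriv v) s =
      g s • deriv (deriv w) s + (2 * deriv g s) • deriv w s + deriv (deriv g) s • w s := by
  intro s hs
  have he : deriv v =ᶠ[nhds s] fun r => g r • deriv w r + deriv g r • w r :=
    Filter.eventually_of_mem (hU.mem_nhds hs) (deriv_smul_eqOn hU hg hw h)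
  rw [he.deriv_eq]
  have hg' := contDiffOn_deriv hU hg
  have hw' := contDiffOn_deriv hU hw
  refine (((hasDerivAt_of_contDiffOn hU hg hs).smul (hasDerivAt_of_contDiffOn hU hw' hs)).add
    ((hasDerivAt_of_contDiffOn hU hg' hs).smul
      (hasDerivAt_of_contDiffOn hU hw hs))).deriv.trans ?_
  module

theorem wronskian_smul {g : ℝ → ℝ} {v w : ℝ → Fin 3 → ℝ} (hU : IsOpen U)
    (hg : ContDiffOn ℝ ∞ g U) (hw : ContDiffOn ℝ ∞ w U) (h : ∀ s ∈ U, v s = g s • w s) :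
    ∀ s ∈ U, wronskian v s = g s ^ 3 * wronskian w s := by
  intro s hs
  rw [wronskian_eq_triple, wronskian_eq_triple, h s hs, deriv_smul_eqOn hU hg hw h s hs,
    deriv_deriv_smul_eqOn hU hg hw h s hs]
  simp only [cross_apply, Matrix.vec3_dotProduct, Pi.add_apply, Pi.smul_apply, smul_eq_mul,
    Matrix.cons_val]
  ring

end Smooth

/-! ### Local lifts -/

section LocalLift

variable {c : ℝ → ℙ ℝ (Fin 3 → ℝ)} {U V : Set ℝ} {v w : ℝ → Fin 3 → ℝ}

theorem IsLocalLift.ne_zero (h : IsLocalLift c U v) {t : ℝ} (ht : t ∈ U) : v t ≠ 0 :=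
  (h.lifts t ht).1

theorem IsLocalLift.mono (h : IsLocalLift c U v) (hV : IsOpen V) (hVU : V ⊆ U) :
    IsLocalLift c V v :=
  ⟨hV, h.smooth.mono hVU, fun t ht => h.lifts t (hVU ht)⟩

theorem IsLocalLift.smul (h : IsLocalLift c U v) {g : ℝ → ℝ} (hg : ContDiffOn ℝ ∞ g U)
    (hg0 : ∀ t ∈ U, g t ≠ 0) : IsLocalLift c U (fun t => g t • v t) := by
  refine ⟨h.isOpen, hg.smul h.smooth, fun t ht => ?_⟩
  obtain ⟨h0, hc⟩ := h.lifts t ht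
  refine ⟨smul_ne_zero (hg0 t ht) h0, hc.trans ?_⟩
  rw [Projectivization.mk_eq_mk_iff']
  exact ⟨(g t)⁻¹, by rw [smul_smul, inv_mul_cancel₀ (hg0 t ht), one_smul]⟩

theorem IsLocalLift.congr (h : IsLocalLift c U v) (hw : ∀ t ∈ U, w t = v t) :
    IsLocalLift c U w := by
  refine ⟨h.isOpen, h.smooth.congr hw, fun t ht => ?_⟩
  rw [hw t ht]
  exact h.lifts t ht

/-- Two local lifts of the same curve differ by a nonvanishing smooth factor. -/
theorem IsLocalLift.exists_eq_smul (hv : IsLocalLift c U v) (hw : IsLocalLift c V w) :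
    ∃ g : ℝ → ℝ, ContDiffOn ℝ ∞ g (U ∩ V) ∧ (∀ t ∈ U ∩ V, g t ≠ 0) ∧
      ∀ t ∈ U ∩ V, v t = g t • w t := by
  have hpos : ∀ t ∈ U ∩ V, w t ⬝ᵥ w t ≠ 0 := fun t ht =>
    fun h => hw.ne_zero ht.2 (dotProduct_self_eq_zero.1 h)
  -- The factor is written as a quotient of dot products so that its smoothness is visible.
  have key : ∀ t ∈ U ∩ V, v t = ((v t ⬝ᵥ w t) / (w t ⬝ᵥ w t)) • w t := by
    intro t ht
    obtain ⟨h1, h2⟩ := hv.lifts t ht.1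
    obtain ⟨h3, h4⟩ := hw.lifts t ht.2
    obtain ⟨a, ha⟩ := (Projectivization.mk_eq_mk_iff' ℝ _ _ h1 h3).1 (h2.symm.trans h4)
    rw [← ha, smul_dotProduct, smul_eq_mul, mul_div_cancel_right₀ _ (hpos t ht)]
  refine ⟨fun t => (v t ⬝ᵥ w t) / (w t ⬝ᵥ w t), ?_, fun t ht h0 => ?_, key⟩
  · have h1 := hv.smooth.mono (Set.inter_subset_left : U ∩ V ⊆ U)
    have h2 := hw.smooth.mono (Set.inter_subset_right : U ∩ V ⊆ V)
    exact (contDiffOn_dotProduct h1 h2).div (contDiffOn_dotProduct h2 h2) hpos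
  · apply hv.ne_zero ht.1
    rw [key t ht]
    exact (congrArg (· • w t) h0).trans (zero_smul _ _)

end LocalLift

/-! ### The normalized lift -/

section NormalizedLift

variable {T : ℝ}

/-- The Wronskian is odd in the lift because the space has odd dimension, so replacing `v` by `-v`
makes it positive; continuity then allows shrinking `U`. -/
theorem ClosedCurve.exists_wronskian_pos (γ : ClosedCurve T) (t : ℝ) :
    ∃ U v, t ∈ U ∧ IsLocalLift γ U v ∧ ∀ s ∈ U, 0 < wronskian v s := by
  have key : ∃ U v, t ∈ U ∧ IsLocalLift γ U v ∧ 0 < wronskian v t := by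
    obtain ⟨U, v, ht, hv, hW⟩ := γ.locally_convex t
    rcases hW.lt_or_gt with hneg | hpos
    · refine ⟨U, fun s => (-1 : ℝ) • v s, ht,
        hv.smul contDiffOn_const fun _ _ => by norm_num, ?_⟩
      rw [wronskian_smul (g := fun _ => -1) hv.isOpen contDiffOn_const hv.smooth
        (fun _ _ => rfl) t ht]
      linarith
    · exact ⟨U, v, ht, hv, hpos⟩
  obtain ⟨U, v, ht, hv, hW⟩ := key
  have hc := (contDiffOn_wronskian hv.isOpen hv.smooth).continuousOn
  have hopen : IsOpen (U ∩ wronskian v ⁻¹' Set.Ioi 0) :=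
    hc.isOpen_inter_preimage hv.isOpen isOpen_Ioi
  exact ⟨U ∩ wronskian v ⁻¹' Set.Ioi 0, v, ⟨ht, hW⟩, hv.mono hopen Set.inter_subset_left,
    fun s hs => hs.2⟩

/-- The two positive Wronskians differ by `g ^ 3`, so `g > 0` and the cube roots differ by exactly
`g`. This independence of the lift is what glues the local normalizations. -/
theorem IsLocalLift.normalization_eq {c : ℝ → ℙ ℝ (Fin 3 → ℝ)} {U V : Set ℝ}
    {v w : ℝ → Fin 3 → ℝ} (hv : IsLocalLift c U v) (hw : IsLocalLift c V w) {t : ℝ}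
    (htU : t ∈ U) (htV : t ∈ V) (hvW : 0 < wronskian v t) (hwW : 0 < wronskian w t) :
    (wronskian v t ^ (3⁻¹ : ℝ))⁻¹ • v t = (wronskian w t ^ (3⁻¹ : ℝ))⁻¹ • w t := by
  obtain ⟨g, hg, hg0, hvw⟩ := hv.exists_eq_smul hw
  have ht : t ∈ U ∩ V := ⟨htU, htV⟩
  have hW := wronskian_smul (hv.isOpen.inter hw.isOpen) hg
    (hw.smooth.mono Set.inter_subset_right) hvw t ht
  have hgpos : 0 < g t := by
    by_contra hneg
    have h3 : g t ^ 3 ≤ 0 := Odd.pow_nonpos (by decide) (not_lt.1 hneg)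
    nlinarith
  have hr : (g t ^ 3) ^ (3⁻¹ : ℝ) = g t := by
    simpa using Real.pow_rpow_inv_natCast hgpos.le (n := 3) (by norm_num)
  rw [hW, Real.mul_rpow (by positivity) hwW.le, hr, hvw t ht, smul_smul, mul_inv,
    mul_right_comm, inv_mul_cancel₀ hgpos.ne', one_mul]

theorem ClosedCurve.exists_isNormalizedLift (γ : ClosedCurve T) :
    ∃ Γ : ℝ → Fin 3 → ℝ, IsNormalizedLift γ Γ := by
  choose U v ht hv hW using γ.exists_wronskian_pos
  let ρ : ℝ → ℝ → ℝ := fun t s => (wronskian (v t) s ^ (3⁻¹ : ℝ))⁻¹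
  let Γ : ℝ → Fin 3 → ℝ := fun t => ρ t t • v t t
  have hρ : ∀ t, ContDiffOn ℝ ∞ (ρ t) (U t) := fun t =>
    (((contDiffOn_wronskian (hv t).isOpen (hv t).smooth).rpow_const_of_ne
      fun s hs => (hW t s hs).ne')).inv fun s hs => (Real.rpow_pos_of_pos (hW t s hs) _).ne'
  -- `Γ s` is defined with the lift chosen at `s` itself; near `t` it may be computed with the
  -- single lift `v t`, which gives smoothness.
  have hΓ : ∀ t, ∀ s ∈ U t, Γ s = ρ t s • v t s := fun t s hs =>
    (hv s).normalization_eq (hv t) (ht s) hs (hW s s (ht s)) (hW t s hs)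
  have hl : ∀ t, IsLocalLift γ (U t) Γ := fun t =>
    ((hv t).smul (hρ t) fun s hs => inv_ne_zero (Real.rpow_pos_of_pos (hW t s hs) _).ne').congr
      (hΓ t)
  refine ⟨Γ, ⟨isOpen_univ, ?_, fun t _ => (hl t).lifts t (ht t)⟩, fun t => ?_⟩
  · exact fun t _ => ((hl t).smooth.contDiffAt ((hv t).isOpen.mem_nhds (ht t))).contDiffWithinAt
  · have h0 := hW t t (ht t)
    rw [wronskian_smul (hv t).isOpen (hρ t) (hv t).smooth (hΓ t) t (ht t)]
    have : (wronskian (v t) t ^ (3⁻¹ : ℝ)) ^ 3 = wronskian (v t) t := by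
      simpa using Real.rpow_inv_natCast_pow h0.le (n := 3) (by norm_num)
    simp only [ρ, inv_pow, this, inv_mul_cancel₀ h0.ne']

theorem IsNormalizedLift.unique {γ : ClosedCurve T} {Γ₁ Γ₂ : ℝ → Fin 3 → ℝ}
    (h₁ : IsNormalizedLift γ Γ₁) (h₂ : IsNormalizedLift γ Γ₂) : Γ₁ = Γ₂ := by
  obtain ⟨g, hg, -, h⟩ := h₁.isLift.exists_eq_smul h₂.isLift
  simp only [Set.inter_univ, Set.mem_univ, true_implies] at hg h
  ext1 t
  have := wronskian_smul isOpen_univ hg h₂.isLift.smooth (fun s _ => h s) t trivial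
  rw [h₁.wronskian_eq, h₂.wronskian_eq, mul_one] at this
  -- The only real root of `g ^ 3 = 1` is 1.
  have hg1 : g t = 1 := by nlinarith [sq_nonneg (g t + 1), sq_nonneg (g t)]
  rw [h t, hg1, one_smul]

theorem deriv_comp_add_period (v : ℝ → Fin 3 → ℝ) (t : ℝ) :
    deriv (fun s => v (s + T)) t = deriv v (t + T) :=
  deriv_comp_add_const v T t

/-- The translate of a normalized lift by `T` is again a normalized lift of the same curve, so
uniqueness excludes any sign monodromy. -/
theorem IsNormalizedLift.periodic {γ : ClosedCurve T} {Γ : ℝ → Fin 3 → ℝ}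
    (h : IsNormalizedLift γ Γ) : Function.Periodic Γ T := by
  refine congrFun (IsNormalizedLift.unique (γ := γ) (Γ₁ := fun t => Γ (t + T)) ⟨⟨isOpen_univ, ?_,
    fun t _ => ?_⟩, fun t => ?_⟩ h)
  · exact h.isLift.smooth.comp (contDiff_id.add contDiff_const).contDiffOn fun _ _ => trivial
  · obtain ⟨h0, h1⟩ := h.isLift.lifts (t + T) trivial
    exact ⟨h0, (γ.periodic t).symm.trans h1⟩
  · rw [← h.wronskian_eq (t + T), wronskian_eq_triple, wronskian_eq_triple,
      show deriv (fun t => Γ (t + T)) = fun t => deriv Γ (t + T) from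
        funext (deriv_comp_add_period Γ), deriv_comp_add_period]

theorem IsNormalizedLift.contDiff {γ : ClosedCurve T} {Γ : ℝ → Fin 3 → ℝ}
    (h : IsNormalizedLift γ Γ) : ContDiff ℝ ∞ Γ :=
  contDiffOn_univ.1 h.isLift.smooth

/-- The closed curve with a given smooth periodic lift of Wronskian one. -/
def ClosedCurve.ofLift (Γ : ℝ → Fin 3 → ℝ) (hs : ContDiff ℝ ∞ Γ) (hW : ∀ t, wronskian Γ t = 1)
    (hp : Function.Periodic Γ T) : ClosedCurve T :=
  have h0 : ∀ t, Γ t ≠ 0 := fun t h => by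
    have := hW t
    simp [wronskian_eq_triple, h] at this
  { toFun := fun t => Projectivization.mk ℝ (Γ t) (h0 t)
    periodic := fun t => by simp only [hp t]
    locally_convex := fun t => ⟨Set.univ, Γ, trivial,
      ⟨isOpen_univ, hs.contDiffOn, fun t _ => ⟨h0 t, rfl⟩⟩, by simp [hW t]⟩ }

theorem isNormalizedLift_ofLift (Γ : ℝ → Fin 3 → ℝ) (hs : ContDiff ℝ ∞ Γ)
    (hW : ∀ t, wronskian Γ t = 1) (hp : Function.Periodic Γ T) :
    IsNormalizedLift (ClosedCurve.ofLift Γ hs hW hp) Γ :=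
  ⟨⟨isOpen_univ, hs.contDiffOn, fun _ _ => ⟨_, rfl⟩⟩, hW⟩

theorem ClosedCurve.eq_of_toFun {γ δ : ClosedCurve T} (h : ∀ t, γ t = δ t) : γ = δ := by
  cases γ; cases δ
  congr
  exact funext h

theorem IsNormalizedLift.eq {γ δ : ClosedCurve T} {Γ : ℝ → Fin 3 → ℝ}
    (hγ : IsNormalizedLift γ Γ) (hδ : IsNormalizedLift δ Γ) : γ = δ :=
  ClosedCurve.eq_of_toFun fun t =>
    (hγ.isLift.lifts t trivial).2.trans (hδ.isLift.lifts t trivial).2.symm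

theorem triple_mulVec (A : Matrix (Fin 3) (Fin 3) ℝ) (u v w : Fin 3 → ℝ) :
    A *ᵥ u ⬝ᵥ (A *ᵥ v) ⨯₃ (A *ᵥ w) = A.det * (u ⬝ᵥ v ⨯₃ w) := by
  have : Matrix.of ![A *ᵥ u, A *ᵥ v, A *ᵥ w] = Matrix.of ![u, v, w] * Aᵀ := by
    ext i j
    fin_cases i <;> simp [Matrix.mul_apply, Matrix.mulVec, dotProduct, mul_comm]
  have hdet := congrArg Matrix.det this
  rw [Matrix.det_mul, Matrix.det_transpose, mul_comm] at hdet
  rw [triple_product_eq_det, triple_product_eq_det]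
  exact hdet

theorem deriv_mulVec (A : Matrix (Fin 3) (Fin 3) ℝ) {v : ℝ → Fin 3 → ℝ} (hv : ContDiff ℝ ∞ v) :
    deriv (fun s => A *ᵥ v s) = fun s => A *ᵥ deriv v s :=
  funext fun s => ((Matrix.mulVecLin A).toContinuousLinearMap.hasFDerivAt.comp_hasDerivAt s
    ((contDiff_infty_iff_deriv.1 hv).1 s).hasDerivAt).deriv

/-- The special linear group acts on normalized lifts. -/
theorem projEquiv_iff {γ₁ γ₂ : ClosedCurve T} {Γ₁ Γ₂ : ℝ → Fin 3 → ℝ}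
    (h₁ : IsNormalizedLift γ₁ Γ₁) (h₂ : IsNormalizedLift γ₂ Γ₂) :
    projEquiv T γ₁ γ₂ ↔ ∃ A : Matrix.SpecialLinearGroup (Fin 3) ℝ, ∀ t, Γ₂ t = A.1 *ᵥ Γ₁ t := by
  constructor
  · rintro ⟨A, hA⟩
    refine ⟨A, congrFun (h₂.unique ⟨⟨isOpen_univ, ?_, fun t _ => ?_⟩, fun t => ?_⟩)⟩
    · exact (Matrix.mulVecLin A.1).toContinuousLinearMap.contDiff.comp_contDiffOn
        h₁.isLift.smooth
    · obtain ⟨h0, hc⟩ := h₁.isLift.lifts t trivial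
      refine ⟨(smul_ne_zero_iff_ne A).2 h0, (hA t).trans ?_⟩
      rw [hc]
      rfl
    · rw [wronskian_eq_triple, deriv_mulVec _ h₁.contDiff,
        deriv_mulVec _ (contDiff_infty_iff_deriv.1 h₁.contDiff).2, triple_mulVec,
        ← wronskian_eq_triple, h₁.wronskian_eq, A.2, one_mul]
  · rintro ⟨A, hA⟩
    refine ⟨A, fun t => ?_⟩
    obtain ⟨h0, hc⟩ := h₁.isLift.lifts t trivial
    obtain ⟨h0', hc'⟩ := h₂.isLift.lifts t trivial
    rw [hc, hc', Projectivization.smul_mk, Projectivization.mk_eq_mk_iff']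
    exact ⟨1, by rw [one_smul, hA t]; rfl⟩

end NormalizedLift

/-! ### Dual pairs of curves -/

/-- The cross products form, up to the determinant, the basis dual to `u, v, w`. -/
theorem triple_smul_eq_cross_expansion (u v w x : Fin 3 → ℝ) :
    (u ⬝ᵥ v ⨯₃ w) • x =
      (x ⬝ᵥ u) • (v ⨯₃ w) + (x ⬝ᵥ v) • (w ⨯₃ u) + (x ⬝ᵥ w) • (u ⨯₃ v) := by
  ext i
  simp only [cross_apply, Matrix.vec3_dotProduct, Pi.add_apply, Pi.smul_apply, smul_eq_mul,
    Matrix.cons_val]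
  fin_cases i <;> simp <;> ring

/-- Two smooth curves in `ℝ³` are dual to each other if each is the cross product of the other
with its velocity; the values of the dot products of their derivatives are recorded as well. -/
structure IsDualPair (a b : ℝ → Fin 3 → ℝ) : Prop where
  smooth_left : ContDiff ℝ ∞ a
  smooth_right : ContDiff ℝ ∞ b
  cross_left : ∀ t, a t ⨯₃ deriv a t = b t
  cross_right : ∀ t, b t ⨯₃ deriv b t = a t
  dot : ∀ t, a t ⬝ᵥ b t = 0
  deriv_dot : ∀ t, deriv a t ⬝ᵥ b t = 0
  dot_deriv : ∀ t, a t ⬝ᵥ deriv b t = 0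
  deriv_dot_deriv : ∀ t, deriv a t ⬝ᵥ deriv b t = -1
  deriv_deriv_dot : ∀ t, deriv (deriv a) t ⬝ᵥ b t = 1
  dot_deriv_deriv : ∀ t, a t ⬝ᵥ deriv (deriv b) t = 1

namespace IsDualPair

variable {a b : ℝ → Fin 3 → ℝ}

theorem symm (h : IsDualPair a b) : IsDualPair b a where
  smooth_left := h.smooth_right
  smooth_right := h.smooth_left
  cross_left := h.cross_right
  cross_right := h.cross_left
  dot t := by rw [dotProduct_comm, h.dot]
  deriv_dot t := by rw [dotProduct_comm, h.dot_deriv]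
  dot_deriv t := by rw [dotProduct_comm, h.deriv_dot]
  deriv_dot_deriv t := by rw [dotProduct_comm, h.deriv_dot_deriv]
  deriv_deriv_dot t := by rw [dotProduct_comm, h.dot_deriv_deriv]
  dot_deriv_deriv t := by rw [dotProduct_comm, h.deriv_deriv_dot]

theorem wronskian_left (h : IsDualPair a b) (t : ℝ) : wronskian a t = 1 := by
  rw [wronskian_eq_triple, ← triple_product_permutation, h.cross_left, h.deriv_deriv_dot]

theorem wronskian_right (h : IsDualPair a b) (t : ℝ) : wronskian b t = 1 :=
  h.symm.wronskian_left t

theorem hasDerivAt_left (h : IsDualPair a b) (t : ℝ) : HasDerivAt a (deriv a t) t :=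
  ((contDiff_infty_iff_deriv.1 h.smooth_left).1 t).hasDerivAt

theorem smooth_deriv_left (h : IsDualPair a b) : ContDiff ℝ ∞ (deriv a) :=
  (contDiff_infty_iff_deriv.1 h.smooth_left).2

theorem hasDerivAt_deriv_left (h : IsDualPair a b) (t : ℝ) :
    HasDerivAt (deriv a) (deriv (deriv a) t) t :=
  ((contDiff_infty_iff_deriv.1 h.smooth_deriv_left).1 t).hasDerivAt

theorem ne_zero_right (h : IsDualPair a b) (t : ℝ) : b t ≠ 0 := fun h0 => by
  simpa [h0] using h.deriv_deriv_dot t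

theorem periodic_right (h : IsDualPair a b) {T : ℝ} (hp : Function.Periodic a T) :
    Function.Periodic b T := by
  intro t
  rw [← h.cross_left, ← h.cross_left, hp t, ← deriv_comp_add_period, funext hp]

/-- A vector orthogonal to `a t` and `a' t` is a multiple of `b t`. -/
theorem eq_smul_right (h : IsDualPair a b) {t : ℝ} {x : Fin 3 → ℝ} (h0 : x ⬝ᵥ a t = 0)
    (h1 : x ⬝ᵥ deriv a t = 0) : x = (x ⬝ᵥ deriv (deriv a) t) • b t := by
  have := triple_smul_eq_cross_expansion (a t) (deriv a t) (deriv (deriv a) t) x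
  rwa [← wronskian_eq_triple, h.wronskian_left, one_smul, h0, h1, zero_smul, zero_smul, zero_add,
    zero_add, h.cross_left] at this

/-- A vector orthogonal to `a t`, `a' t` and `a'' t` is zero. -/
theorem eq_zero_of_dot (h : IsDualPair a b) {t : ℝ} {x : Fin 3 → ℝ} (h0 : x ⬝ᵥ a t = 0)
    (h1 : x ⬝ᵥ deriv a t = 0) (h2 : x ⬝ᵥ deriv (deriv a) t = 0) : x = 0 := by
  rw [h.eq_smul_right h0 h1, h2, zero_smul]

end IsDualPair

/-- Since a' × a' = 0, the velocity of a × a' is a × a''; every recorded dot product then reduces to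
a triple product of a, a', a'' or to one with a repeated factor. -/
theorem isDualPair_of_wronskian {a : ℝ → Fin 3 → ℝ} (hs : ContDiff ℝ ∞ a)
    (hW : ∀ t, wronskian a t = 1) : IsDualPair a (fun t => a t ⨯₃ deriv a t) := by
  have hs1 := (contDiff_infty_iff_deriv.1 hs).2
  have hs2 := (contDiff_infty_iff_deriv.1 hs1).2
  have h0 := fun t => ((contDiff_infty_iff_deriv.1 hs).1 t).hasDerivAt
  have h1 := fun t => ((contDiff_infty_iff_deriv.1 hs1).1 t).hasDerivAt
  have h2 := fun t => ((contDiff_infty_iff_deriv.1 hs2).1 t).hasDerivAt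
  have hb : deriv (fun t => a t ⨯₃ deriv a t) = fun t => a t ⨯₃ deriv (deriv a) t := by
    ext1 t
    rw [(hasDerivAt_crossProduct (h0 t) (h1 t)).deriv, cross_self, zero_add]
  have hb2 : ∀ t, deriv (fun t => a t ⨯₃ deriv (deriv a) t) t =
      deriv a t ⨯₃ deriv (deriv a) t + a t ⨯₃ deriv (deriv (deriv a)) t := fun t =>
    (hasDerivAt_crossProduct (h0 t) (h2 t)).deriv
  simp only [wronskian_eq_triple] at hW
  refine ⟨hs, ?_, fun _ => rfl, fun t => ?_, fun t => ?_, fun t => ?_, fun t => ?_, fun t => ?_,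
    fun t => ?_, fun t => ?_⟩
  · exact contDiffOn_univ.1 (contDiffOn_crossProduct hs.contDiffOn hs1.contDiffOn)
  · rw [hb]
    -- The identity used is (a × a') × (a × a'') = det(a, a', a'') a.
    have := congrArg (· • a t) (hW t)
    rw [one_smul] at this
    refine Eq.trans ?_ this
    ext i
    simp only [cross_apply, Matrix.vec3_dotProduct, Pi.smul_apply, smul_eq_mul, Matrix.cons_val]
    fin_cases i <;> simp <;> ring
  · exact dot_self_cross _ _
  · exact dot_cross_self _ _
  · rw [hb]
    exact dot_self_cross _ _
  · simp only [hb]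
    rw [← cross_anticomm, dotProduct_neg, ← triple_product_permutation, hW]
  · rw [triple_product_permutation, hW]
  · rw [hb, hb2, dotProduct_add, hW, dot_self_cross, add_zero]

/-! ### Tangent lines and the dual curve -/

section DualCurve

variable {T : ℝ}

theorem IsNormalizedLift.isDualPair {γ : ClosedCurve T} {Γ : ℝ → Fin 3 → ℝ}
    (h : IsNormalizedLift γ Γ) : IsDualPair Γ (fun t => Γ t ⨯₃ deriv Γ t) :=
  isDualPair_of_wronskian h.contDiff h.wronskian_eq

/-- The tangent line is spanned by Γ and Γ', whose common normals are the multiples of Γ*. Any other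
lift gΓ has its velocity in the same span. -/
theorem isDualCurve_iff {γ δ : ClosedCurve T} {Γ Γdual : ℝ → Fin 3 → ℝ}
    (hγ : IsNormalizedLift γ Γ) (h : IsDualPair Γ Γdual) :
    IsDualCurve γ δ ↔ IsNormalizedLift δ Γdual := by
  constructor
  · intro hδ
    refine ⟨⟨isOpen_univ, h.smooth_right.contDiffOn, fun t _ => ⟨h.ne_zero_right t, ?_⟩⟩,
      h.wronskian_right⟩
    obtain ⟨h0, h1⟩ := hδ t Set.univ Γ trivial hγ.isLift
    rw [← (δ t).mk_rep, Projectivization.mk_eq_mk_iff']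
    exact ⟨_, (h.eq_smul_right h0 h1).symm⟩
  · intro hδ t U v ht hv
    obtain ⟨g, hg, -, hgv⟩ := hv.exists_eq_smul hγ.isLift
    simp only [Set.inter_univ] at hg hgv
    obtain ⟨h0, hc⟩ := hδ.isLift.lifts t trivial
    rw [← (δ t).mk_rep, Projectivization.mk_eq_mk_iff'] at hc
    obtain ⟨k, hk⟩ := hc
    rw [← hk, hgv t ht, deriv_smul_eqOn hv.isOpen hg (h.smooth_left.contDiffOn) hgv t ht]
    simp [h.symm.dot t, h.symm.dot_deriv t]

theorem ClosedCurve.existsUnique_dual (γ : ClosedCurve T) :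
    ∃! δ : ClosedCurve T, IsDualCurve γ δ := by
  obtain ⟨Γ, hΓ⟩ := γ.exists_isNormalizedLift
  have h := hΓ.isDualPair
  have hδ := isNormalizedLift_ofLift _ h.smooth_right h.wronskian_right
    (h.periodic_right hΓ.periodic)
  exact ⟨_, (isDualCurve_iff hΓ h).2 hδ, fun δ' hδ' => ((isDualCurve_iff hΓ h).1 hδ').eq hδ⟩

end DualCurve

/-! ### The frieze of a dual pair -/

theorem dx_dot (a b : ℝ → Fin 3 → ℝ) (ha : ContDiff ℝ ∞ a) :
    dx (fun x y => a x ⬝ᵥ b y) = fun x y => deriv a x ⬝ᵥ b y := by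
  ext x y
  simpa [dx, dy] using (hasDerivAt_dotProduct ((contDiff_infty_iff_deriv.1 ha).1 x).hasDerivAt
    (hasDerivAt_const x (b y))).deriv

theorem dy_dot (a b : ℝ → Fin 3 → ℝ) (hb : ContDiff ℝ ∞ b) :
    dy (fun x y => a x ⬝ᵥ b y) = fun x y => a x ⬝ᵥ deriv b y := by
  ext x y
  simpa [dx, dy] using (hasDerivAt_dotProduct (hasDerivAt_const y (a x))
    ((contDiff_infty_iff_deriv.1 hb).1 y).hasDerivAt).deriv

namespace IsDualPair

variable {a b : ℝ → Fin 3 → ℝ}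

theorem isClosedEntry (h : IsDualPair a b) {T : ℝ} (hp : Function.Periodic a T) :
    IsClosedEntry T (fun x y => a x ⬝ᵥ b y) where
  diag := h.dot
  diag_x x := by simp only [dx_dot _ _ h.smooth_left, h.deriv_dot]
  diag_y x := by simp only [dy_dot _ _ h.smooth_right, h.dot_deriv]
  diag_xx x := by
    simp only [dx_dot _ _ h.smooth_left, dx_dot _ _ h.smooth_deriv_left, h.deriv_deriv_dot]
  diag_yy x := by
    simp only [dy_dot _ _ h.smooth_right, dy_dot _ _ h.symm.smooth_deriv_left, h.dot_deriv_deriv]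
  diag_xy x := by
    simp only [dx_dot _ _ h.smooth_left, dy_dot _ _ h.smooth_right, h.deriv_dot_deriv]
  periodic_x x y := by rw [hp x]
  periodic_y x y := by rw [h.periodic_right hp y]

/-- Binet–Cauchy applied to (a × a')(x) · (b × b')(y). -/
theorem frieze_rule (h : IsDualPair a b) (x y : ℝ) :
    b x ⬝ᵥ a y = a x ⬝ᵥ b y * (deriv a x ⬝ᵥ deriv b y) -
      (deriv a x ⬝ᵥ b y) * (a x ⬝ᵥ deriv b y) := by
  rw [← h.cross_left x, ← h.cross_right y, cross_dot_cross]
  ring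

theorem contDiff_dot (h : IsDualPair a b) :
    ContDiff ℝ ∞ (fun p : ℝ × ℝ => a p.1 ⬝ᵥ b p.2) := by
  have ha := contDiff_pi.1 h.smooth_left
  have hb := contDiff_pi.1 h.smooth_right
  simp only [Matrix.vec3_dotProduct]
  exact ((((ha 0).comp contDiff_fst).mul ((hb 0).comp contDiff_snd)).add
    (((ha 1).comp contDiff_fst).mul ((hb 1).comp contDiff_snd))).add
    (((ha 2).comp contDiff_fst).mul ((hb 2).comp contDiff_snd))

/-- The closed continuous 2-frieze `F (x, y) = a x ⬝ᵥ b y` of a periodic dual pair. -/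
def frieze (h : IsDualPair a b) {T : ℝ} (hp : Function.Periodic a T) : ClosedTwoFrieze T where
  F x y := a x ⬝ᵥ b y
  G x y := b x ⬝ᵥ a y
  smooth_F := h.contDiff_dot
  smooth_G := h.symm.contDiff_dot
  G_eq x y := by
    rw [dx_dot _ _ h.smooth_left, dy_dot _ _ h.smooth_right, dy_dot _ _ h.smooth_right]
    exact h.frieze_rule x y
  F_eq x y := by
    rw [dx_dot _ _ h.smooth_right, dy_dot _ _ h.smooth_left, dy_dot _ _ h.smooth_left]
    exact h.symm.frieze_rule x y
  closed_F := h.isClosedEntry hp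
  closed_G := h.symm.isClosedEntry (h.periodic_right hp)

end IsDualPair

/-- A closed continuous 2-frieze is determined by its first function. -/
theorem ClosedTwoFrieze.eq_of_F {T : ℝ} {P Q : ClosedTwoFrieze T} (h : P.F = Q.F) : P = Q := by
  have hG : P.G = Q.G := by
    ext x y
    rw [P.G_eq, Q.G_eq, h]
  cases P; cases Q
  cases h; cases hG
  rfl

/-! ### Partial derivatives of smooth functions of two variables -/

/-- Smooth functions of two variables, in curried form. -/
def IsSmooth (F : ℝ → ℝ → ℝ) : Prop := ContDiff ℝ ∞ (fun p : ℝ × ℝ => F p.1 p.2)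

namespace IsSmooth

variable {F G : ℝ → ℝ → ℝ}

theorem mul (hF : IsSmooth F) (hG : IsSmooth G) : IsSmooth fun x y => F x y * G x y :=
  ContDiff.mul hF hG

theorem add (hF : IsSmooth F) (hG : IsSmooth G) : IsSmooth fun x y => F x y + G x y :=
  ContDiff.add hF hG

theorem sub (hF : IsSmooth F) (hG : IsSmooth G) : IsSmooth fun x y => F x y - G x y :=
  ContDiff.sub hF hG

theorem curve (hF : IsSmooth F) (y : ℝ) : ContDiff ℝ ∞ fun x => F x y :=
  ContDiff.comp (g := fun p : ℝ × ℝ => F p.1 p.2) hF (contDiff_id.prodMk contDiff_const)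

theorem hasFDerivAt (hF : IsSmooth F) (p : ℝ × ℝ) :
    HasFDerivAt (fun p : ℝ × ℝ => F p.1 p.2) (fderiv ℝ (fun p : ℝ × ℝ => F p.1 p.2) p) p :=
  (ContDiff.differentiable hF (by simp) p).hasFDerivAt

theorem hasDerivAt_fst (hF : IsSmooth F) (x y : ℝ) :
    HasDerivAt (fun s => F s y) (fderiv ℝ (fun p : ℝ × ℝ => F p.1 p.2) (x, y) (1, 0)) x :=
  HasFDerivAt.comp_hasDerivAt (f := fun s => (s, y)) x (hF.hasFDerivAt (x, y))
    ((hasDerivAt_id x).prodMk (hasDerivAt_const x y))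

theorem hasDerivAt_snd (hF : IsSmooth F) (x y : ℝ) :
    HasDerivAt (fun s => F x s) (fderiv ℝ (fun p : ℝ × ℝ => F p.1 p.2) (x, y) (0, 1)) y :=
  HasFDerivAt.comp_hasDerivAt (f := fun s => (x, s)) y (hF.hasFDerivAt (x, y))
    ((hasDerivAt_const y x).prodMk (hasDerivAt_id y))

theorem dx_eq (hF : IsSmooth F) (x y : ℝ) :
    dx F x y = fderiv ℝ (fun p : ℝ × ℝ => F p.1 p.2) (x, y) (1, 0) :=
  (hF.hasDerivAt_fst x y).deriv

theorem dy_eq (hF : IsSmooth F) (x y : ℝ) :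
    dy F x y = fderiv ℝ (fun p : ℝ × ℝ => F p.1 p.2) (x, y) (0, 1) :=
  (hF.hasDerivAt_snd x y).deriv

theorem hasDerivAt_dx (hF : IsSmooth F) (x y : ℝ) :
    HasDerivAt (fun s => F s y) (dx F x y) x :=
  hF.dx_eq x y ▸ hF.hasDerivAt_fst x y

theorem hasDerivAt_dy (hF : IsSmooth F) (x y : ℝ) :
    HasDerivAt (fun s => F x s) (dy F x y) y :=
  hF.dy_eq x y ▸ hF.hasDerivAt_snd x y

theorem contDiff_fderiv (hF : IsSmooth F) :
    ContDiff ℝ ∞ (fderiv ℝ (fun p : ℝ × ℝ => F p.1 p.2)) :=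
  ContDiff.fderiv_right hF (by simp)

theorem dx (hF : IsSmooth F) : IsSmooth (dx F) := by
  simp only [IsSmooth, hF.dx_eq]
  exact hF.contDiff_fderiv.clm_apply contDiff_const

theorem dy (hF : IsSmooth F) : IsSmooth (dy F) := by
  simp only [IsSmooth, hF.dy_eq]
  exact hF.contDiff_fderiv.clm_apply contDiff_const

theorem dx_dy_comm (hF : IsSmooth F) : TwoFrieze.dx (TwoFrieze.dy F) =
    TwoFrieze.dy (TwoFrieze.dx F) := by
  ext x y
  have hd := (hF.contDiff_fderiv.differentiable (by simp) (x, y)).hasFDerivAt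
  have key : ∀ v w : ℝ × ℝ, fderiv ℝ (fun p => fderiv ℝ (fun p : ℝ × ℝ => F p.1 p.2) p v) (x, y) w =
      fderiv ℝ (fderiv ℝ (fun p : ℝ × ℝ => F p.1 p.2)) (x, y) w v := fun v w => by
    simpa using congrArg (· w) (hd.clm_apply (hasFDerivAt_const v (x, y))).fderiv
  rw [hF.dy.dx_eq, hF.dx.dy_eq]
  simp only [hF.dx_eq, hF.dy_eq, key]
  exact (contDiff_infty.1 hF 2).contDiffAt.isSymmSndFDerivAt (by simp) _ _

theorem dx_eventually_zero (hF : IsSmooth F) {p : ℝ × ℝ} (h : ∀ᶠ q in nhds p, F q.1 q.2 = 0) :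
    ∀ᶠ q in nhds p, TwoFrieze.dx F q.1 q.2 = 0 := by
  have := Filter.EventuallyEq.fderiv (𝕜 := ℝ) (f₁ := fun q : ℝ × ℝ => F q.1 q.2)
    (f := fun _ => 0) h
  filter_upwards [this] with q hq
  rw [hF.dx_eq, hq]
  simp

theorem dy_eventually_zero (hF : IsSmooth F) {p : ℝ × ℝ} (h : ∀ᶠ q in nhds p, F q.1 q.2 = 0) :
    ∀ᶠ q in nhds p, TwoFrieze.dy F q.1 q.2 = 0 := by
  have := Filter.EventuallyEq.fderiv (𝕜 := ℝ) (f₁ := fun q : ℝ × ℝ => F q.1 q.2)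
    (f := fun _ => 0) h
  filter_upwards [this] with q hq
  rw [hF.dy_eq, hq]
  simp

end IsSmooth

/-- The partial derivative of order `i` in the first and `j` in the second variable. -/
def partialD (F : ℝ → ℝ → ℝ) (i j : ℕ) : ℝ → ℝ → ℝ := dy^[j] (dx^[i] F)

section PartialD

variable {F : ℝ → ℝ → ℝ}

theorem IsSmooth.partialD (hF : IsSmooth F) (i j : ℕ) : IsSmooth (partialD F i j) := by
  have h : IsSmooth (TwoFrieze.dx^[i] F) := by
    induction i with
    | zero => exact hF
    | succ i ih => rw [Function.iterate_succ_apply']; exact ih.dx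
  unfold TwoFrieze.partialD
  induction j with
  | zero => exact h
  | succ j ih => rw [Function.iterate_succ_apply']; exact ih.dy

theorem dy_partialD (F : ℝ → ℝ → ℝ) (i j : ℕ) : dy (partialD F i j) = partialD F i (j + 1) :=
  (Function.iterate_succ_apply' dy j _).symm

theorem dx_partialD (hF : IsSmooth F) (i j : ℕ) :
    dx (partialD F i j) = partialD F (i + 1) j := by
  induction j with
  | zero => exact (Function.iterate_succ_apply' dx i F).symm
  | succ j ih => rw [← dy_partialD, (hF.partialD i j).dx_dy_comm, ih, dy_partialD]

theorem hasDerivAt_partialD_fst (hF : IsSmooth F) (i j : ℕ) (x y : ℝ) :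
    HasDerivAt (fun s => partialD F i j s y) (partialD F (i + 1) j x y) x :=
  dx_partialD hF i j ▸ (hF.partialD i j).hasDerivAt_dx x y

theorem hasDerivAt_partialD_snd (hF : IsSmooth F) (i j : ℕ) (x y : ℝ) :
    HasDerivAt (fun s => partialD F i j x s) (partialD F i (j + 1) x y) y :=
  dy_partialD F i j ▸ (hF.partialD i j).hasDerivAt_dy x y

theorem partialD_zero_zero (F : ℝ → ℝ → ℝ) : partialD F 0 0 = F := rfl

/-- The determinant of the mixed partial derivatives of order at most two in each variable. -/
def wronskian₂ (F : ℝ → ℝ → ℝ) (x y : ℝ) : ℝ :=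
  partialD F 0 0 x y * (partialD F 1 1 x y * partialD F 2 2 x y -
      partialD F 1 2 x y * partialD F 2 1 x y) -
    partialD F 0 1 x y * (partialD F 1 0 x y * partialD F 2 2 x y -
      partialD F 1 2 x y * partialD F 2 0 x y) +
    partialD F 0 2 x y * (partialD F 1 0 x y * partialD F 2 1 x y -
      partialD F 1 1 x y * partialD F 2 0 x y)

theorem IsSmooth.wronskian₂ (hF : IsSmooth F) : IsSmooth (wronskian₂ F) := by
  have h := hF.partialD
  exact (((h 0 0).mul (((h 1 1).mul (h 2 2)).sub ((h 1 2).mul (h 2 1)))).sub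
    ((h 0 1).mul (((h 1 0).mul (h 2 2)).sub ((h 1 2).mul (h 2 0))))).add
    ((h 0 2).mul (((h 1 0).mul (h 2 1)).sub ((h 1 1).mul (h 2 0))))

/-- The row F, F_y, F_yy of the determinant vanishes. -/
theorem wronskian₂_eq_zero_of_eventually (hF : IsSmooth F) {p : ℝ × ℝ}
    (h : ∀ᶠ q in nhds p, F q.1 q.2 = 0) : wronskian₂ F p.1 p.2 = 0 := by
  have h1 := hF.dy_eventually_zero h
  have h2 := hF.dy.dy_eventually_zero h1
  have e0 : TwoFrieze.partialD F 0 0 p.1 p.2 = 0 := h.self_of_nhds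
  have e1 : TwoFrieze.partialD F 0 1 p.1 p.2 = 0 := h1.self_of_nhds
  have e2 : TwoFrieze.partialD F 0 2 p.1 p.2 = 0 := h2.self_of_nhds
  simp only [wronskian₂, e0, e1, e2]
  ring

end PartialD

/-! ### The differential equation of a frieze -/

namespace ClosedTwoFrieze

variable {T : ℝ} (P : ClosedTwoFrieze T)

theorem isSmooth_F : IsSmooth P.F := P.smooth_F

theorem isSmooth_G : IsSmooth P.G := P.smooth_G

theorem G_eq_partialD : P.G = fun x y => partialD P.F 0 0 x y * partialD P.F 1 1 x y -
    partialD P.F 1 0 x y * partialD P.F 0 1 x y :=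
  funext fun x => funext fun y => P.G_eq x y

/-- Dodgson condensation of `wronskian₂ F`, together with the frieze rule. -/
theorem F_eq_mul_wronskian₂ (x y : ℝ) : P.F x y = P.F x y * wronskian₂ P.F x y := by
  have hx := hasDerivAt_partialD_fst P.isSmooth_F
  have hy := hasDerivAt_partialD_snd P.isSmooth_F
  -- G, G_x, G_y and G_xy are the four 2 × 2 minors through the corner entry F of the 3 × 3 matrix,
  -- since in each differentiation the remaining terms cancel. Then G G_xy − G_x G_y is F times the
  -- full determinant.
  have e1 : dx P.G = fun x y => partialD P.F 0 0 x y * partialD P.F 2 1 x y -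
      partialD P.F 2 0 x y * partialD P.F 0 1 x y := by
    ext x y
    rw [dx, G_eq_partialD]
    refine (((hx 0 0 x y).fun_mul (hx 1 1 x y)).fun_sub
      ((hx 1 0 x y).fun_mul (hx 0 1 x y))).deriv.trans ?_
    simp only [zero_add, Nat.reduceAdd]
    ring
  have e2 : dy P.G x y = partialD P.F 0 0 x y * partialD P.F 1 2 x y -
      partialD P.F 1 0 x y * partialD P.F 0 2 x y := by
    rw [dy, G_eq_partialD]
    refine (((hy 0 0 x y).fun_mul (hy 1 1 x y)).fun_sub
      ((hy 1 0 x y).fun_mul (hy 0 1 x y))).deriv.trans ?_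
    simp only [zero_add, Nat.reduceAdd]
    ring
  have e3 : dy (dx P.G) x y = partialD P.F 0 1 x y * partialD P.F 2 1 x y +
      partialD P.F 0 0 x y * partialD P.F 2 2 x y -
      (partialD P.F 2 1 x y * partialD P.F 0 1 x y +
        partialD P.F 2 0 x y * partialD P.F 0 2 x y) := by
    rw [e1]
    exact (((hy 0 0 x y).fun_mul (hy 2 1 x y)).fun_sub
      ((hy 2 0 x y).fun_mul (hy 0 1 x y))).deriv
  have hF := P.F_eq x y
  rw [e3, e2, e1, G_eq_partialD] at hF
  refine hF.trans ?_
  rw [wronskian₂, partialD_zero_zero]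
  ring

/-- The boundary values make the matrix anti-triangular with anti-diagonal 1, −1, 1, so its other
entries do not matter. -/
theorem wronskian₂_diag (x : ℝ) : wronskian₂ P.F x x = 1 := by
  have h := P.closed_F
  have h00 : partialD P.F 0 0 x x = 0 := h.diag x
  have h10 : partialD P.F 1 0 x x = 0 := h.diag_x x
  have h01 : partialD P.F 0 1 x x = 0 := h.diag_y x
  have h20 : partialD P.F 2 0 x x = 1 := h.diag_xx x
  have h02 : partialD P.F 0 2 x x = 1 := h.diag_yy x
  have h11 : partialD P.F 1 1 x x = -1 := h.diag_xy x
  rw [wronskian₂, h00, h10, h01, h20, h02, h11]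
  ring

/-- Where the determinant differs from 1, it does so nearby too, so F = F·W forces F = 0 nearby and
hence W = 0. A continuous function on the plane with values in {0, 1} is constant. -/
theorem wronskian₂_eq_one (x y : ℝ) : wronskian₂ P.F x y = 1 := by
  have hc : Continuous fun p : ℝ × ℝ => wronskian₂ P.F p.1 p.2 :=
    ContDiff.continuous P.isSmooth_F.wronskian₂
  have h01 : ∀ p : ℝ × ℝ, wronskian₂ P.F p.1 p.2 ≠ 1 → wronskian₂ P.F p.1 p.2 = 0 := by
    intro p hp
    apply wronskian₂_eq_zero_of_eventually P.isSmooth_F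
    filter_upwards [hc.continuousAt.eventually_ne hp] with q hq
    have := P.F_eq_mul_wronskian₂ q.1 q.2
    by_contra h0
    exact hq (mul_left_cancel₀ h0 (by rw [← this, mul_one]))
  have hclopen : IsClopen {p : ℝ × ℝ | wronskian₂ P.F p.1 p.2 = 1} := by
    refine ⟨isClosed_eq hc continuous_const, ?_⟩
    have : {p : ℝ × ℝ | wronskian₂ P.F p.1 p.2 = 1} = {p | wronskian₂ P.F p.1 p.2 ≠ 0} := by
      ext p
      constructor
      · intro (hp : _ = _)
        simp [hp]
      · intro hp
        by_contra h
        exact hp (h01 p h)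
    rw [this]
    exact isOpen_ne_fun hc continuous_const
  exact Set.eq_univ_iff_forall.1 (hclopen.eq_univ ⟨(0, 0), P.wronskian₂_diag 0⟩) (x, y)

/-- The second function of a frieze does not vanish on a nonempty open set. -/
theorem eq_zero_of_mul_G {S : ℝ → ℝ → ℝ} (hS : IsSmooth S) (h : ∀ x y, S x y * P.G x y = 0)
    (x y : ℝ) : S x y = 0 := by
  by_contra h0
  have hc : Continuous fun p : ℝ × ℝ => S p.1 p.2 := ContDiff.continuous hS
  have hG : ∀ᶠ q in nhds (x, y), P.G q.1 q.2 = 0 := by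
    filter_upwards [hc.continuousAt.eventually_ne h0] with q hq
    exact (mul_eq_zero.1 (h q.1 q.2)).resolve_left hq
  have hF : ∀ᶠ q in nhds (x, y), P.F q.1 q.2 = 0 := by
    filter_upwards [hG, P.isSmooth_G.dx_eventually_zero hG] with q hq hq'
    rw [P.F_eq, hq, hq']
    ring
  have := wronskian₂_eq_zero_of_eventually P.isSmooth_F hF
  simp [P.wronskian₂_eq_one] at this

/-- As a function of `x`, each `∂ʲF/∂yʲ` solves the same linear differential equation. -/
theorem exists_ode : ∃ a b : ℝ → ℝ, ∀ x y, ∀ j < 3,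
    partialD P.F 3 j x y = a x * partialD P.F 0 j x y + b x * partialD P.F 1 j x y := by
  set D := partialD P.F with hD
  have h : ∀ i j, IsSmooth (D i j) := P.isSmooth_F.partialD
  have hx : ∀ i j x y, HasDerivAt (fun s => D i j s y) (D (i + 1) j x y) x :=
    hasDerivAt_partialD_fst P.isSmooth_F
  have hy : ∀ i j x y, HasDerivAt (fun s => D i j x s) (D i (j + 1) x y) y :=
    hasDerivAt_partialD_snd P.isSmooth_F
  have hW : ∀ x y, D 0 0 x y * (D 1 1 x y * D 2 2 x y - D 1 2 x y * D 2 1 x y) -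
      D 0 1 x y * (D 1 0 x y * D 2 2 x y - D 1 2 x y * D 2 0 x y) +
      D 0 2 x y * (D 1 0 x y * D 2 1 x y - D 1 1 x y * D 2 0 x y) = 1 := P.wronskian₂_eq_one
  -- The x-derivative of W = 1: only the term where the last row is differentiated has no repeated
  -- row.
  have hc : ∀ x y, D 0 0 x y * (D 1 1 x y * D 3 2 x y - D 1 2 x y * D 3 1 x y) -
      D 0 1 x y * (D 1 0 x y * D 3 2 x y - D 1 2 x y * D 3 0 x y) +
      D 0 2 x y * (D 1 0 x y * D 3 1 x y - D 1 1 x y * D 3 0 x y) = 0 := by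
    intro x y
    have hd := (((hx 0 0 x y).fun_mul (((hx 1 1 x y).fun_mul (hx 2 2 x y)).fun_sub
      ((hx 1 2 x y).fun_mul (hx 2 1 x y)))).fun_sub ((hx 0 1 x y).fun_mul
      (((hx 1 0 x y).fun_mul (hx 2 2 x y)).fun_sub ((hx 1 2 x y).fun_mul (hx 2 0 x y))))).fun_add
      ((hx 0 2 x y).fun_mul (((hx 1 0 x y).fun_mul (hx 2 1 x y)).fun_sub
      ((hx 1 1 x y).fun_mul (hx 2 0 x y))))
    simp only [hW] at hd
    refine Eq.trans ?_ (hd.unique (hasDerivAt_const x 1))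
    simp only [zero_add, Nat.reduceAdd]
    ring
  -- Cramer's rule for row 3 in terms of rows 0, 1, 2; the coefficient of row 2 is the determinant
  -- in `hc`, which is zero.
  let a : ℝ → ℝ → ℝ := fun x y =>
    D 3 0 x y * (D 1 1 x y * D 2 2 x y - D 1 2 x y * D 2 1 x y) -
      D 3 1 x y * (D 1 0 x y * D 2 2 x y - D 1 2 x y * D 2 0 x y) +
      D 3 2 x y * (D 1 0 x y * D 2 1 x y - D 1 1 x y * D 2 0 x y)
  let b : ℝ → ℝ → ℝ := fun x y =>
    D 0 0 x y * (D 3 1 x y * D 2 2 x y - D 3 2 x y * D 2 1 x y) -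
      D 0 1 x y * (D 3 0 x y * D 2 2 x y - D 3 2 x y * D 2 0 x y) +
      D 0 2 x y * (D 3 0 x y * D 2 1 x y - D 3 1 x y * D 2 0 x y)
  have ha : IsSmooth a := (((h 3 0).mul (((h 1 1).mul (h 2 2)).sub ((h 1 2).mul (h 2 1)))).sub
    ((h 3 1).mul (((h 1 0).mul (h 2 2)).sub ((h 1 2).mul (h 2 0))))).add
    ((h 3 2).mul (((h 1 0).mul (h 2 1)).sub ((h 1 1).mul (h 2 0))))
  have hb : IsSmooth b := (((h 0 0).mul (((h 3 1).mul (h 2 2)).sub ((h 3 2).mul (h 2 1)))).sub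
    ((h 0 1).mul (((h 3 0).mul (h 2 2)).sub ((h 3 2).mul (h 2 0))))).add
    ((h 0 2).mul (((h 3 0).mul (h 2 1)).sub ((h 3 1).mul (h 2 0))))
  have hode : ∀ x y, ∀ j < 3, D 3 j x y = a x y * D 0 j x y + b x y * D 1 j x y := by
    intro x y j hj
    interval_cases j
    · linear_combination (-D 3 0 x y) * hW x y + D 2 0 x y * hc x y
    · linear_combination (-D 3 1 x y) * hW x y + D 2 1 x y * hc x y
    · linear_combination (-D 3 2 x y) * hW x y + D 2 2 x y * hc x y
  -- Differentiating relation `j` in y and subtracting relation `j + 1` leaves a homogeneous system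
  -- for (a_y, b_y) whose determinant is G. As G vanishes on no nonempty open set, a and b do not
  -- depend on y.
  have hdiff : ∀ j < 2, ∀ x y, dy a x y * D 0 j x y + dy b x y * D 1 j x y = 0 := by
    intro j hj x y
    have h1 := ((ha.hasDerivAt_dy x y).fun_mul (hy 0 j x y)).fun_add
      ((hb.hasDerivAt_dy x y).fun_mul (hy 1 j x y))
    have h2 := hy 3 j x y
    rw [show (fun s => D 3 j x s) = _ from funext fun s => hode x s j (by omega)] at h2
    linear_combination h1.unique h2 + hode x y (j + 1) (by omega)
  have hG : ∀ x y, P.G x y = D 0 0 x y * D 1 1 x y - D 1 0 x y * D 0 1 x y := P.G_eq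
  have hay := P.eq_zero_of_mul_G ha.dy fun x y => by
    rw [hG]
    linear_combination D 1 1 x y * hdiff 0 (by omega) x y - D 1 0 x y * hdiff 1 (by omega) x y
  have hby := P.eq_zero_of_mul_G hb.dy fun x y => by
    rw [hG]
    linear_combination D 0 0 x y * hdiff 1 (by omega) x y - D 0 1 x y * hdiff 0 (by omega) x y
  have hconst : ∀ f : ℝ → ℝ → ℝ, IsSmooth f → (∀ x y, dy f x y = 0) → ∀ x y, f x y = f x 0 :=
    fun f hf h0 x y => is_const_of_deriv_eq_zero
      (fun y => (hf.hasDerivAt_dy x y).differentiableAt) (h0 x) y 0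
  refine ⟨fun x => a x 0, fun x => b x 0, fun x y j hj => ?_⟩
  rw [hode x y j hj, hconst a ha hay x y, hconst b hb hby x y]

/-- The curve `x ↦ (F, F_y, F_yy)(x, 0)` of a frieze. -/
def curve (x : ℝ) : Fin 3 → ℝ :=
  ![partialD P.F 0 0 x 0, partialD P.F 0 1 x 0, partialD P.F 0 2 x 0]

theorem hasDerivAt_partialD_vec (i : ℕ) (x : ℝ) :
    HasDerivAt (fun x => ![partialD P.F i 0 x 0, partialD P.F i 1 x 0, partialD P.F i 2 x 0])
      ![partialD P.F (i + 1) 0 x 0, partialD P.F (i + 1) 1 x 0, partialD P.F (i + 1) 2 x 0] x := by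
  rw [hasDerivAt_pi]
  intro j
  fin_cases j <;> exact hasDerivAt_partialD_fst P.isSmooth_F i _ x 0

theorem deriv_curve : deriv P.curve =
    fun x => ![partialD P.F 1 0 x 0, partialD P.F 1 1 x 0, partialD P.F 1 2 x 0] :=
  funext fun x => (P.hasDerivAt_partialD_vec 0 x).deriv

theorem deriv_deriv_curve : deriv (deriv P.curve) =
    fun x => ![partialD P.F 2 0 x 0, partialD P.F 2 1 x 0, partialD P.F 2 2 x 0] := by
  rw [deriv_curve]
  exact funext fun x => (P.hasDerivAt_partialD_vec 1 x).deriv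

theorem contDiff_curve : ContDiff ℝ ∞ P.curve := by
  rw [contDiff_pi]
  intro j
  fin_cases j <;> exact (P.isSmooth_F.partialD 0 _).curve 0

theorem wronskian_curve (x : ℝ) : wronskian P.curve x = 1 := by
  rw [← P.wronskian₂_eq_one x 0, wronskian, Matrix.det_fin_three, deriv_deriv_curve, deriv_curve,
    wronskian₂]
  simp [curve]
  ring

theorem periodic_curve : Function.Periodic P.curve T := by
  intro x
  simp [curve, partialD, dy, P.closed_F.periodic_x]

/-- For fixed `y`, F(·, y) and Γ(·)·Γ*(y) solve the same third-order equation with the same 2-jet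
(0, 0, 1) at `y`. Instead of a uniqueness theorem, a conserved vector is used. -/
theorem F_eq_dot (x y : ℝ) : P.F x y = P.curve x ⬝ᵥ P.curve y ⨯₃ deriv P.curve y := by
  obtain ⟨a, b, hab⟩ := P.exists_ode
  set Γ := P.curve
  have h0 : ∀ t, HasDerivAt Γ (deriv Γ t) t := fun t =>
    ((contDiff_infty_iff_deriv.1 P.contDiff_curve).1 t).hasDerivAt
  have h1 : ∀ t, HasDerivAt (deriv Γ) (deriv (deriv Γ) t) t := fun t => by
    rw [P.deriv_deriv_curve, P.deriv_curve]
    exact P.hasDerivAt_partialD_vec 1 t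
  have h2 : ∀ t, HasDerivAt (deriv (deriv Γ)) (a t • Γ t + b t • deriv Γ t) t := fun t => by
    rw [P.deriv_deriv_curve, P.deriv_curve]
    refine (P.hasDerivAt_partialD_vec 2 t).congr_deriv ?_
    ext j
    fin_cases j
    · exact hab t 0 0 (by omega)
    · exact hab t 0 1 (by omega)
    · exact hab t 0 2 (by omega)
  have hu := fun i t => hasDerivAt_partialD_fst P.isSmooth_F i 0 t y
  -- `c t` is the vector whose dot products with Γ, Γ', Γ'' at `t` are F, F_x, F_xx at `(t, y)`. The
  -- differential equation makes it constant, and at `t = y` it is Γ × Γ'.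
  let c : ℝ → Fin 3 → ℝ := fun t => partialD P.F 0 0 t y • (deriv Γ t ⨯₃ deriv (deriv Γ) t) +
    partialD P.F 1 0 t y • (deriv (deriv Γ) t ⨯₃ Γ t) + partialD P.F 2 0 t y • (Γ t ⨯₃ deriv Γ t)
  have hc : ∀ t, HasDerivAt c 0 t := fun t => by
    refine ((((hu 0 t).smul (hasDerivAt_crossProduct (h1 t) (h2 t))).add
      ((hu 1 t).smul (hasDerivAt_crossProduct (h2 t) (h0 t)))).add
      ((hu 2 t).smul (hasDerivAt_crossProduct (h0 t) (h1 t)))).congr_deriv ?_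
    simp only [zero_add, Nat.reduceAdd, hab t y 0 (by omega), cross_self, map_add, map_smul,
      LinearMap.add_apply, LinearMap.smul_apply, smul_zero, add_zero]
    rw [← cross_anticomm (deriv Γ t) (Γ t), ← cross_anticomm (deriv (deriv Γ) t) (deriv Γ t),
      ← cross_anticomm (deriv (deriv Γ) t) (Γ t)]
    module
  have hcc : c x = c y :=
    is_const_of_deriv_eq_zero (fun t => (hc t).differentiableAt) (fun t => (hc t).deriv) x y
  have e0 : partialD P.F 0 0 y y = 0 := P.closed_F.diag y
  have e1 : partialD P.F 1 0 y y = 0 := P.closed_F.diag_x y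
  have e2 : partialD P.F 2 0 y y = 1 := P.closed_F.diag_xx y
  have hcy : c y = Γ y ⨯₃ deriv Γ y := by
    simp only [c, e0, e1, e2, zero_smul, one_smul, zero_add]
  have hW := P.wronskian_curve x
  rw [wronskian_eq_triple] at hW
  rw [← hcy, ← hcc]
  simp only [c, dotProduct_add, dotProduct_smul, dot_self_cross, dot_cross_self]
  rw [hW]
  simp [partialD_zero_zero]

theorem exists_isDualPair : ∃ Γ Γdual : ℝ → Fin 3 → ℝ, IsDualPair Γ Γdual ∧
    Function.Periodic Γ T ∧ ∀ x y, P.F x y = Γ x ⬝ᵥ Γdual y :=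
  ⟨P.curve, _, isDualPair_of_wronskian P.contDiff_curve P.wronskian_curve, P.periodic_curve,
    P.F_eq_dot⟩

end ClosedTwoFrieze

/-! ### Intersection multiplicities -/

section Multiplicity

variable {T : ℝ} {γ : ClosedCurve T} {Γ Γdual : ℝ → Fin 3 → ℝ} {ℓ : Fin 3 → ℝ} {t : ℝ}

/-- The order of contact with a line may be computed in the normalized lift. -/
theorem meetsToOrder_iff (hΓ : IsNormalizedLift γ Γ) {n : ℕ} :
    MeetsToOrder γ ℓ t n ↔ ∀ i < n, iteratedDeriv i (fun s => ℓ ⬝ᵥ Γ s) t = 0 := by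
  refine ⟨fun ⟨U, v, ht, hv, h⟩ i hi => ?_, fun h => ⟨Set.univ, Γ, trivial, hΓ.isLift, h⟩⟩
  obtain ⟨g, hg, -, hgv⟩ := hΓ.isLift.exists_eq_smul hv
  simp only [Set.univ_inter] at hg hgv
  have hU := hv.isOpen.mem_nhds ht
  have he : (fun s => ℓ ⬝ᵥ Γ s) =ᶠ[nhds t] fun s => g s * (ℓ ⬝ᵥ v s) := by
    filter_upwards [hU] with s hs
    rw [hgv s hs, dotProduct_smul, smul_eq_mul]
  have hd := (contDiffOn_dotProduct contDiffOn_const hv.smooth (a := fun _ => ℓ)).contDiffAt hU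
  rw [he.iteratedDeriv_eq, iteratedDeriv_fun_mul
    ((hg.contDiffAt hU).of_le (mod_cast le_top)) (hd.of_le (mod_cast le_top))]
  -- By the Leibniz rule each term contains a derivative of `ℓ ⬝ᵥ v` of order at most `i`.
  exact Finset.sum_eq_zero fun j _ => by rw [h (i - j) (by omega), mul_zero]

theorem le_interMult {n : ℕ} (h : MeetsToOrder γ ℓ t n) : (n : ℕ∞) ≤ interMult γ ℓ t :=
  le_iSup₂ (f := fun (n : ℕ) (_ : MeetsToOrder γ ℓ t n) => (n : ℕ∞)) n h

theorem interMult_le {n : ℕ} (h : ¬ MeetsToOrder γ ℓ t (n + 1)) : interMult γ ℓ t ≤ n := by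
  refine iSup₂_le fun m ⟨U, v, ht, hv, hm⟩ => Nat.cast_le.2 ?_
  by_contra hlt
  exact h ⟨U, v, ht, hv, fun i hi => hm i (by omega)⟩

theorem hasDerivAt_dot_left (h : IsDualPair Γ Γdual) (ℓ : Fin 3 → ℝ) (t : ℝ) :
    HasDerivAt (fun s => ℓ ⬝ᵥ Γ s) (ℓ ⬝ᵥ deriv Γ t) t := by
  simpa using hasDerivAt_dotProduct (hasDerivAt_const t ℓ) (h.hasDerivAt_left t)

theorem hasDerivAt_dot_deriv_left (h : IsDualPair Γ Γdual) (ℓ : Fin 3 → ℝ) (t : ℝ) :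
    HasDerivAt (fun s => ℓ ⬝ᵥ deriv Γ s) (ℓ ⬝ᵥ deriv (deriv Γ) t) t := by
  simpa using hasDerivAt_dotProduct (hasDerivAt_const t ℓ) (h.hasDerivAt_deriv_left t)

theorem deriv_dot_left (h : IsDualPair Γ Γdual) (ℓ : Fin 3 → ℝ) :
    deriv (fun s => ℓ ⬝ᵥ Γ s) = fun s => ℓ ⬝ᵥ deriv Γ s :=
  funext fun t => (hasDerivAt_dot_left h ℓ t).deriv

theorem meetsToOrder_one_iff (hΓ : IsNormalizedLift γ Γ) :
    MeetsToOrder γ ℓ t 1 ↔ ℓ ⬝ᵥ Γ t = 0 := by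
  simp [meetsToOrder_iff hΓ]

theorem meetsToOrder_two_iff (hΓ : IsNormalizedLift γ Γ) :
    MeetsToOrder γ ℓ t 2 ↔ ℓ ⬝ᵥ Γ t = 0 ∧ ℓ ⬝ᵥ deriv Γ t = 0 := by
  simp only [meetsToOrder_iff hΓ, Nat.forall_lt_succ_right, Nat.not_lt_zero, IsEmpty.forall_iff,
    implies_true, true_and, iteratedDeriv_zero, iteratedDeriv_one, deriv_dot_left hΓ.isDualPair]

theorem meetsToOrder_three_iff (hΓ : IsNormalizedLift γ Γ) :
    MeetsToOrder γ ℓ t 3 ↔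
      (ℓ ⬝ᵥ Γ t = 0 ∧ ℓ ⬝ᵥ deriv Γ t = 0) ∧ ℓ ⬝ᵥ deriv (deriv Γ) t = 0 := by
  simp only [meetsToOrder_iff hΓ, Nat.forall_lt_succ_right, Nat.not_lt_zero, IsEmpty.forall_iff,
    implies_true, true_and, iteratedDeriv_zero, iteratedDeriv_one,
    iteratedDeriv_succ (n := 1), deriv_dot_left hΓ.isDualPair,
    (hasDerivAt_dot_deriv_left hΓ.isDualPair ℓ t).deriv]

theorem interMult_eq_zero (hΓ : IsNormalizedLift γ Γ) (h : ℓ ⬝ᵥ Γ t ≠ 0) :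
    interMult γ ℓ t = 0 :=
  nonpos_iff_eq_zero.1 <| interMult_le (n := 0) fun h' => h ((meetsToOrder_one_iff hΓ).1 h')

theorem interMult_le_one (hΓ : IsNormalizedLift γ Γ) (h : ℓ ⬝ᵥ deriv Γ t ≠ 0) :
    interMult γ ℓ t ≤ 1 :=
  interMult_le (n := 1) fun h' => h ((meetsToOrder_two_iff hΓ).1 h').2

/-- Γ, Γ', Γ'' span the space, so no nonzero form has contact of order three. -/
theorem interMult_le_two (hΓ : IsNormalizedLift γ Γ) (h : ℓ ≠ 0) : interMult γ ℓ t ≤ 2 :=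
  interMult_le (n := 2) fun h' => h <| by
    obtain ⟨⟨h0, h1⟩, h2⟩ := (meetsToOrder_three_iff hΓ).1 h'
    exact hΓ.isDualPair.eq_zero_of_dot h0 h1 h2

end Multiplicity

/-! ### Positivity and convexity -/

section Convexity

variable {T : ℝ} {γ : ClosedCurve T} {Γ Γdual : ℝ → Fin 3 → ℝ}

/-- If the products `Γ x ⬝ᵥ Γdual y` are positive, a line that meets the curve transversally at
`x` meets it at most once more. -/
theorem IsDualPair.not_three_zeros (h : IsDualPair Γ Γdual)
    (hpos : ∀ x y, x < y → y < x + T → 0 < Γ x ⬝ᵥ Γdual y ∧ 0 < Γdual x ⬝ᵥ Γ y)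
    {ℓ : Fin 3 → ℝ} {x y z : ℝ} (hxy : x < y) (hyz : y < z) (hzx : z < x + T)
    (hx : ℓ ⬝ᵥ Γ x = 0) (hx' : ℓ ⬝ᵥ deriv Γ x ≠ 0) (hy : ℓ ⬝ᵥ Γ y = 0) : ℓ ⬝ᵥ Γ z ≠ 0 := by
  intro hz
  -- Rolle's theorem is applied to ℓ·Γ divided by the equation of the tangent line at `x`, which is
  -- positive on `[y, z]`.
  have hne : ∀ t ∈ Set.Icc y z, Γdual x ⬝ᵥ Γ t ≠ 0 := fun t ht =>
    (hpos x t (by linarith [ht.1]) (by linarith [ht.2])).2.ne'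
  have hq : ∀ t ∈ Set.Icc y z, HasDerivAt (fun s => (ℓ ⬝ᵥ Γ s) / (Γdual x ⬝ᵥ Γ s))
      (((ℓ ⬝ᵥ deriv Γ t) * (Γdual x ⬝ᵥ Γ t) - (ℓ ⬝ᵥ Γ t) * (Γdual x ⬝ᵥ deriv Γ t)) /
        (Γdual x ⬝ᵥ Γ t) ^ 2) t := fun t ht =>
    (hasDerivAt_dot_left h ℓ t).fun_div (hasDerivAt_dot_left h (Γdual x) t) (hne t ht)
  obtain ⟨c, hc, hc0⟩ := exists_hasDerivAt_eq_zero hyz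
    (fun t ht => (hq t ht).continuousAt.continuousWithinAt) (by simp [hy, hz])
    fun t ht => hq t (Set.Ioo_subset_Icc_self ht)
  have hnum := (div_eq_zero_iff.1 hc0).resolve_right
    (pow_ne_zero 2 (hne c (Set.Ioo_subset_Icc_self hc)))
  -- The numerator is (Γ*(x) × ℓ)·Γ*(c). Since ℓ·Γ(x) = 0, the first factor is −(ℓ·Γ'(x)) Γ(x), so
  -- the numerator is a nonzero multiple of Γ(x)·Γ*(c) > 0.
  have h1 := cross_dot_cross (Γdual x) ℓ (Γ c) (deriv Γ c)
  rw [h.cross_left, ← h.cross_left x, cross_cross_eq_smul_sub_smul, h.cross_left,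
    dotProduct_comm (Γ x), hx, zero_smul, zero_sub, neg_dotProduct, smul_dotProduct,
    dotProduct_comm (deriv Γ x), smul_eq_mul] at h1
  have h2 := (hpos x c (by linarith [hc.1]) (by linarith [hc.2])).1
  exact mul_ne_zero hx' h2.ne' (by linarith)

theorem isConvex_of_positive (hΓ : IsNormalizedLift γ Γ) (h : IsDualPair Γ Γdual)
    (hpos : ∀ x y, x < y → y < x + T → 0 < Γ x ⬝ᵥ Γdual y ∧ 0 < Γdual x ⬝ᵥ Γ y) :
    γ.IsConvex := by
  intro ℓ hℓ s hs
  -- A line tangent at `t₀` is a multiple of Γ*(t₀), hence meets the curve nowhere else in the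
  -- period. Otherwise all intersections are simple and it suffices to count them.
  by_cases hdouble : ∃ t ∈ s, ℓ ⬝ᵥ Γ t = 0 ∧ ℓ ⬝ᵥ deriv Γ t = 0
  · obtain ⟨t₀, ht₀, h0, h1⟩ := hdouble
    have hℓeq := h.eq_smul_right h0 h1
    have hk : ℓ ⬝ᵥ deriv (deriv Γ) t₀ ≠ 0 := fun h2 => hℓ (h.eq_zero_of_dot h0 h1 h2)
    rw [Finset.sum_eq_single_of_mem t₀ ht₀ fun t ht hne => interMult_eq_zero hΓ ?_]
    · exact interMult_le_two hΓ hℓ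
    · rw [hℓeq, smul_dotProduct, smul_eq_mul]
      refine mul_ne_zero hk ?_
      have h3 := hs t ht
      have h4 := hs t₀ ht₀
      rcases hne.lt_or_gt with hlt | hgt
      · rw [dotProduct_comm]
        exact (hpos t t₀ hlt (by linarith)).1.ne'
      · exact (hpos t₀ t hgt (by linarith)).2.ne'
  · push Not at hdouble
    have hsum : ∑ t ∈ s, interMult γ ℓ t ≤ ∑ t ∈ s, if ℓ ⬝ᵥ Γ t = 0 then (1 : ℕ∞) else 0 := by
      refine Finset.sum_le_sum fun t ht => ?_
      split_ifs with h0
      · exact interMult_le_one hΓ (hdouble t ht h0)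
      · exact (interMult_eq_zero hΓ h0).le
    refine hsum.trans ?_
    rw [Finset.sum_boole]
    set Z := s.filter fun t => ℓ ⬝ᵥ Γ t = 0 with hZ
    suffices Z.card ≤ 2 by exact_mod_cast this
    by_contra! hcard
    have hZne : Z.Nonempty := Finset.card_pos.1 (by omega)
    have hmin := Z.min'_mem hZne
    -- With the smallest zero as `x`, all the others lie in `(x, x + T)`.
    set x := Z.min' hZne
    have hcard' : 1 < (Z.erase x).card := by
      rw [Finset.card_erase_of_mem hmin]
      omega
    have key : ∀ y ∈ Z.erase x, ∀ z ∈ Z.erase x, ¬ y < z := by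
      intro y hy z hz hyz
      have hyZ := Finset.mem_of_mem_erase hy
      have hzZ := Finset.mem_of_mem_erase hz
      have hxy : x < y := lt_of_le_of_ne (Z.min'_le y hyZ) (Finset.ne_of_mem_erase hy).symm
      rw [hZ, Finset.mem_filter] at hmin hyZ hzZ
      refine h.not_three_zeros hpos hxy hyz ?_ hmin.2 (hdouble x hmin.1 hmin.2) hyZ.2 hzZ.2
      linarith [(hs z hzZ.1).2, (hs x hmin.1).1]
    obtain ⟨y, hy, z, hz, hyz⟩ := Finset.one_lt_card.1 hcard'
    rcases hyz.lt_or_gt with hlt | hgt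
    · exact key y hy z hz hlt
    · exact key z hz y hy hgt

/-- The tangent line at `p` already has multiplicity two there; a further point would make three.
Both parameters are first reduced to `[0, T)`, where they stay distinct. -/
theorem dot_ne_zero_of_isConvex (hT : 0 < T) (hΓ : IsNormalizedLift γ Γ) (h : IsDualPair Γ Γdual)
    (hconv : γ.IsConvex) {p t : ℝ} (hpt : p < t) (htp : t < p + T) : Γdual p ⬝ᵥ Γ t ≠ 0 := by
  intro h0
  set p₀ := toIcoMod hT 0 p
  set t₀ := toIcoMod hT 0 t
  have hp := h.periodic_right hΓ.periodic
  have hp₀ : Γdual p₀ = Γdual p := hp.sub_zsmul_eq _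
  have ht₀ : Γ t₀ = Γ t := hΓ.periodic.sub_zsmul_eq _
  have hne : p₀ ≠ t₀ := by
    intro he
    obtain ⟨n, hn⟩ := (toIcoMod_eq_toIcoMod hT).1 he
    rw [zsmul_eq_mul] at hn
    have h1 : (0 : ℝ) < n := by
      by_contra hle
      nlinarith
    have h2 : (n : ℝ) < 1 := by
      by_contra hle
      nlinarith
    norm_cast at h1 h2
    omega
  have hsum := hconv (Γdual p₀) (h.ne_zero_right p₀) {p₀, t₀} (by
    intro r hr
    rw [Finset.mem_insert, Finset.mem_singleton] at hr
    rcases hr with rfl | rfl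
    · simpa using toIcoMod_mem_Ico hT 0 p
    · simpa using toIcoMod_mem_Ico hT 0 t)
  rw [Finset.sum_pair hne] at hsum
  have h2 : ((2 : ℕ) : ℕ∞) ≤ interMult γ (Γdual p₀) p₀ := le_interMult
    ((meetsToOrder_two_iff hΓ).2 ⟨h.symm.dot p₀, h.symm.dot_deriv p₀⟩)
  have h1 : ((1 : ℕ) : ℕ∞) ≤ interMult γ (Γdual p₀) t₀ := le_interMult
    ((meetsToOrder_one_iff hΓ).2 (by rw [hp₀, ht₀, h0]))
  have h3 := (add_le_add h2 h1).trans hsum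
  exact absurd h3 (by decide)

theorem positive_of_isConvex (hT : 0 < T) (hΓ : IsNormalizedLift γ Γ) (h : IsDualPair Γ Γdual)
    (hconv : γ.IsConvex) {x y : ℝ} (hxy : x < y) (hyx : y < x + T) :
    0 < Γ x ⬝ᵥ Γdual y ∧ 0 < Γdual x ⬝ᵥ Γ y := by
  have key : ∀ p t, p < t → t < p + T → 0 < Γdual p ⬝ᵥ Γ t := by
    intro p t hpt htp
    have hne := fun s (h1 : p < s) (h2 : s < p + T) => dot_ne_zero_of_isConvex hT hΓ h hconv h1 h2
    have hd := hasDerivAt_dot_left h (Γdual p)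
    -- The second derivative at the double zero `p` is 1, which fixes the sign just to the right of
    -- `p`; the absence of zeros then propagates it.
    have hmin : IsLocalMin (fun s => Γdual p ⬝ᵥ Γ s) p := by
      apply isLocalMin_of_deriv_deriv_pos
      · rw [deriv_dot_left h, (hasDerivAt_dot_deriv_left h _ p).deriv, h.symm.dot_deriv_deriv]
        exact one_pos
      · rw [deriv_dot_left h]
        exact h.symm.dot_deriv p
      · exact (hd p).continuousAt
    have hev : ∀ᶠ s in nhdsWithin p (Set.Ioi p), 0 ≤ Γdual p ⬝ᵥ Γ s := by
      filter_upwards [nhdsWithin_le_nhds hmin] with s hs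
      simpa only [h.symm.dot p] using hs
    obtain ⟨r, hr0, hpr, hrt⟩ := (hev.and (Ioo_mem_nhdsGT hpt)).exists
    by_contra hneg
    obtain ⟨c, hc, hc0⟩ := intermediate_value_Icc' hrt.le
      (fun s _ => (hd s).continuousAt.continuousWithinAt) ⟨not_lt.1 hneg, hr0⟩
    exact hne c (by linarith [hc.1]) (by linarith [hc.2]) hc0
  refine ⟨?_, key x y hxy hyx⟩
  -- By periodicity F(x, y) = G(y, x + T).
  rw [dotProduct_comm, ← hΓ.periodic x]
  exact key y (x + T) hyx (by linarith)

end Convexity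

/-! ### The correspondence -/

section Correspondence

variable {T : ℝ}

/-- The frieze of a closed locally convex curve. -/
def ClosedCurve.frieze (γ : ClosedCurve T) : ClosedTwoFrieze T :=
  have h := γ.exists_isNormalizedLift.choose_spec
  h.isDualPair.frieze h.periodic

theorem ClosedCurve.frieze_eq {γ : ClosedCurve T} {Γ Γdual : ℝ → Fin 3 → ℝ}
    (hΓ : IsNormalizedLift γ Γ) (h : IsDualPair Γ Γdual) :
    γ.frieze = h.frieze hΓ.periodic := by
  apply ClosedTwoFrieze.eq_of_F
  obtain rfl := γ.exists_isNormalizedLift.choose_spec.unique hΓ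
  obtain rfl := funext h.cross_left
  rfl

/-- F(x, y) is the triple product of Γ(x), Γ(y), Γ'(y), which SL₃ preserves. -/
theorem frieze_eq_of_projEquiv {γ₁ γ₂ : ClosedCurve T} (h : projEquiv T γ₁ γ₂) :
    γ₁.frieze = γ₂.frieze := by
  obtain ⟨Γ₁, h₁⟩ := γ₁.exists_isNormalizedLift
  obtain ⟨Γ₂, h₂⟩ := γ₂.exists_isNormalizedLift
  obtain ⟨A, hA⟩ := (projEquiv_iff h₁ h₂).1 h
  obtain rfl : Γ₂ = fun t => A.1 *ᵥ Γ₁ t := funext hA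
  rw [ClosedCurve.frieze_eq h₁ h₁.isDualPair, ClosedCurve.frieze_eq h₂ h₂.isDualPair]
  apply ClosedTwoFrieze.eq_of_F
  ext x y
  simp only [IsDualPair.frieze, deriv_mulVec _ h₁.contDiff, triple_mulVec, A.2, one_mul]

/-- A curve is recovered up to projective equivalence from its frieze. -/
theorem IsNormalizedLift.exists_curve_eq {γ : ClosedCurve T} {Γ : ℝ → Fin 3 → ℝ}
    (hΓ : IsNormalizedLift γ Γ) :
    ∃ A : Matrix.SpecialLinearGroup (Fin 3) ℝ, ∀ t, γ.frieze.curve t = A.1 *ᵥ Γ t := by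
  have h := hΓ.isDualPair
  set Γdual := fun t => Γ t ⨯₃ deriv Γ t
  -- The matrix has rows Γ*, Γ*', Γ*'' at 0, so its determinant is the Wronskian of Γ*.
  refine ⟨⟨_, h.wronskian_right 0⟩, fun t => ?_⟩
  rw [ClosedCurve.frieze_eq hΓ h]
  have h0 : partialD (h.frieze hΓ.periodic).F 0 0 = fun x y => Γ x ⬝ᵥ Γdual y := rfl
  have h1 : partialD (h.frieze hΓ.periodic).F 0 1 = fun x y => Γ x ⬝ᵥ deriv Γdual y := by
    rw [← dy_partialD, h0, dy_dot _ _ h.smooth_right]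
  have h2 : partialD (h.frieze hΓ.periodic).F 0 2 =
      fun x y => Γ x ⬝ᵥ deriv (deriv Γdual) y := by
    rw [← dy_partialD, h1, dy_dot _ _ h.symm.smooth_deriv_left]
  rw [ClosedTwoFrieze.curve, h0, h1, h2]
  ext i
  fin_cases i
  · exact dotProduct_comm (Γ t) (Γdual 0)
  · exact dotProduct_comm (Γ t) (deriv Γdual 0)
  · exact dotProduct_comm (Γ t) (deriv (deriv Γdual) 0)

/-- Both normalized lifts are SL₃-equivalent to the curve built from the common frieze. -/
theorem projEquiv_of_frieze_eq {γ₁ γ₂ : ClosedCurve T} (h : γ₁.frieze = γ₂.frieze) :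
    projEquiv T γ₁ γ₂ := by
  obtain ⟨Γ₁, h₁⟩ := γ₁.exists_isNormalizedLift
  obtain ⟨Γ₂, h₂⟩ := γ₂.exists_isNormalizedLift
  obtain ⟨A, hA⟩ := h₁.exists_curve_eq
  obtain ⟨B, hB⟩ := h₂.exists_curve_eq
  refine (projEquiv_iff h₁ h₂).2 ⟨B⁻¹ * A, fun t => ?_⟩
  have hAB : A • Γ₁ t = B • Γ₂ t := (hA t).symm.trans (h ▸ hB t)
  change Γ₂ t = (B⁻¹ * A) • Γ₁ t
  rw [mul_smul, hAB, inv_smul_smul]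

theorem exists_frieze_eq (P : ClosedTwoFrieze T) : ∃ γ : ClosedCurve T, γ.frieze = P := by
  obtain ⟨Γ, Γdual, h, hp, hF⟩ := P.exists_isDualPair
  refine ⟨ClosedCurve.ofLift Γ h.smooth_left h.wronskian_left hp, ?_⟩
  rw [ClosedCurve.frieze_eq (isNormalizedLift_ofLift _ _ _ _) h]
  exact ClosedTwoFrieze.eq_of_F (funext fun x => funext fun y => (hF x y).symm)

/-- Projective classes of closed locally convex curves correspond to closed continuous
2-friezes. -/
def classEquivFrieze (T : ℝ) : Quotient (projEquiv T) ≃ ClosedTwoFrieze T :=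
  Equiv.ofBijective (Quotient.lift ClosedCurve.frieze fun _ _ => frieze_eq_of_projEquiv) <| by
    constructor
    · rintro ⟨γ₁⟩ ⟨γ₂⟩ h
      exact Quotient.sound (projEquiv_of_frieze_eq h)
    · intro P
      obtain ⟨γ, hγ⟩ := exists_frieze_eq P
      exact ⟨Quotient.mk _ γ, hγ⟩

end Correspondence

end TwoFrieze

end

theorem mainTheorem1 (T : ℝ) (hT : 0 < T) :
    (∀ γ : TwoFrieze.ClosedCurve T, ∃! Γ : ℝ → Fin 3 → ℝ, TwoFrieze.IsNormalizedLift γ Γ) ∧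
    (∀ γ : TwoFrieze.ClosedCurve T, ∃! δ : TwoFrieze.ClosedCurve T,
      TwoFrieze.IsDualCurve γ δ) ∧
    ∃ Φ : TwoFrieze.ClosedTwoFrieze T ≃ Quotient (TwoFrieze.projEquiv T),
      ∀ (P : TwoFrieze.ClosedTwoFrieze T) (γ : TwoFrieze.ClosedCurve T),
        Φ P = Quotient.mk (TwoFrieze.projEquiv T) γ →
          (∀ (δ : TwoFrieze.ClosedCurve T) (Γ Γdual : ℝ → Fin 3 → ℝ),
            TwoFrieze.IsDualCurve γ δ → TwoFrieze.IsNormalizedLift γ Γ →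
            TwoFrieze.IsNormalizedLift δ Γdual → ∀ x y, P.F x y = Γ x ⬝ᵥ Γdual y) ∧
          (P.IsPositive ↔ γ.IsConvex) := by
  refine ⟨fun γ => ?_, fun γ => γ.existsUnique_dual,
    (TwoFrieze.classEquivFrieze T).symm, fun P γ hPγ => ?_⟩
  · obtain ⟨Γ, hΓ⟩ := γ.exists_isNormalizedLift
    exact ⟨Γ, hΓ, fun Γ' hΓ' => hΓ'.unique hΓ⟩
  obtain rfl : P = γ.frieze := (Equiv.symm_apply_eq _).1 hPγ
  constructor
  · intro δ Γ Γdual hδ hΓ hΓdual x y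
    have h := hΓ.isDualPair
    rw [hΓdual.unique ((TwoFrieze.isDualCurve_iff hΓ h).1 hδ),
      TwoFrieze.ClosedCurve.frieze_eq hΓ h]
    rfl
  · obtain ⟨Γ, hΓ⟩ := γ.exists_isNormalizedLift
    have h := hΓ.isDualPair
    rw [TwoFrieze.ClosedCurve.frieze_eq hΓ h]
    exact ⟨TwoFrieze.isConvex_of_positive hΓ h,
      fun hc x y hxy hyx => TwoFrieze.positive_of_isConvex hT hΓ h hc hxy hyx⟩
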